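/- Let $M$ be a smooth (paracompact, Hausdorff) manifold of even dimension $n\ge 2$ with a semi-Riemannian metric $g$ of arbitrary signature, oriented, with volume form $\mu$. Let $\xi$ be a smooth complex vector bundle of finite rank over $M$ with a smooth Clifford action $\gamma$ of $(T^*M,g)$, i.e. $\gamma(\alpha)\gamma(\beta)+\gamma(\beta)\gamma(\alpha)=2\epsilon\, g(\alpha,\beta)$ with a fixed sign $\epsilon\in\{1,-1\}$. Let $\gamma_M$ be the multiple of $\gamma(\mu)=\frac1{n!}\mu_{i_1\dots i_n}\gamma(e^{i_1})\cdots\gamma(e^{i_n})$, by a fourth root of unity, that satisfies $\gamma_M^2=1$. Identify $\mathrm{End}(\xi)=\mathrm{Cl}^{\mathbb C}\otimes\mathrm{End}_{\mathrm{Cl}}(\xi)$, so that $\phi\in\mathrm{End}_{\mathrm{Cl}}(\xi)$ is an endomorphism that commutes with $\gamma(\alpha)$ for all $\alpha$ and $\gamma_M\otimes\phi=\gamma_M\circ\phi$. Let $\chi$ be a smooth section of $\mathrm{End}_{\mathrm{Cl}}(\xi)$ with $\chi^2=1$, and grade $\xi$ by $\Gamma=\gamma_M\otimes\chi$; $\mathrm{End}^-_{\mathrm{Cl}}(\xi)$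 consists of the $\phi\in\mathrm{End}_{\mathrm{Cl}}(\xi)$ with $\Gamma\phi=-\phi\Gamma$. A Dirac type operator is a complex linear operator $D'$ on the smooth sections of $\xi$ that is odd ($D'\Gamma=-\Gamma D'$) and satisfies $[D',f]=\gamma(df)$ for all smooth real functions $f$. A Clifford connection is a connection $A$ on $\xi$ whose covariant derivative $\partial_A$ satisfies $[\partial_{A,X},\gamma(\alpha)]=\gamma(\nabla_X\alpha)$ for all vector fields $X$ and one-forms $\alpha$, where $\nabla$ is the Levi-Civita connection; put $/\!\!\!\partial_A=\gamma\circ\partial_A$. The Bochner-Laplacian of $D'$ is $\triangle=\epsilon\,\mathrm{tr}_g(\hat\nabla^{T^*M\otimes\xi}\circ\hat\nabla)$ for the unique connection $\hat\nabla$ on $\xi$ such that $D'^2-\triangle$ is of order zero, i.e. a section of $\mathrm{End}(\xi)$. The operator $D'$ is of simple type if $\hat\nabla$ is a Clifford connection. The Dirac form of $D'$ is $\varpi=\Theta\wedge(D'-\gamma\circ\hat\nabla)$, where $\Theta(X)=\frac{\epsilon}{n}\gamma(X^\flat)$ and $(\Theta\wedge\Psi)(X)=\Theta(X)\circ\Psi$.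 For a Dirac type operator $D'$ the following are equivalent: 1. $D'$ is of simple type; 2. $D'=/\!\!\!\partial_A+\gamma_M\otimes\phi$ for a Clifford connection $A$ and a smooth section $\phi$ of $\mathrm{End}^-_{\mathrm{Cl}}(\xi)$; 3. the Dirac form of $D'$ is $\Theta\wedge(\gamma_M\otimes\phi)$ for a smooth section $\phi$ of $\mathrm{End}^-_{\mathrm{Cl}}(\xi)$. Moreover, a section $\phi$ of $\mathrm{End}^-_{\mathrm{Cl}}(\xi)$ satisfies the equation in 2 for some Clifford connection $A$ if and only if it satisfies the one in 3, and if $D'$ is of simple type, then $\phi$ and $A$ are uniquely determined by $D'$. -/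

import Mathlib

open Bundle
open scoped Manifold ContDiff

noncomputable section

namespace SimpleType

/-! ## Semi-Riemannian geometry on a smooth `n`-manifold -/

section Geometry

variable {n : ℕ} {M : Type*} [TopologicalSpace M] [ChartedSpace (EuclideanSpace ℝ (Fin n)) M]

/-- The coordinate basis of `T_x M` given by the preferred chart at `x`. -/
def frame (x : M) (i : Fin n) : TangentSpace (𝓡 n) x :=
  (EuclideanSpace.single i (1 : ℝ) : EuclideanSpace ℝ (Fin n))

/-- The basis of `T_x^* M` dual to `frame x`. -/
def coframe (x : M) (i : Fin n) : TangentSpace (𝓡 n) x →L[ℝ] ℝ :=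
  (EuclideanSpace.proj i : EuclideanSpace ℝ (Fin n) →L[ℝ] ℝ)

variable [IsManifold (𝓡 n) ∞ M]

/-- Smoothness of a vector field. -/
def SmoothField (X : ∀ x : M, TangentSpace (𝓡 n) x) : Prop :=
  ContMDiff (𝓡 n) ((𝓡 n).prod 𝓘(ℝ, EuclideanSpace ℝ (Fin n))) ∞
    (fun x ↦ TotalSpace.mk' (EuclideanSpace ℝ (Fin n)) x (X x))

variable (n M) in
/-- A smooth semi-Riemannian metric (of arbitrary signature) on `M`. -/
structure SemiRiemannianMetric where
  inner (x : M) : TangentSpace (𝓡 n) x →L[ℝ] TangentSpace (𝓡 n) x →L[ℝ] ℝ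
  symm (x : M) (u v : TangentSpace (𝓡 n) x) : inner x u v = inner x v u
  nondegenerate (x : M) (u : TangentSpace (𝓡 n) x) : (∀ v, inner x u v = 0) → u = 0
  contMDiff : ContMDiff (𝓡 n) ((𝓡 n).prod
      𝓘(ℝ, EuclideanSpace ℝ (Fin n) →L[ℝ] EuclideanSpace ℝ (Fin n) →L[ℝ] ℝ)) ∞
    (fun x ↦ TotalSpace.mk'
      (EuclideanSpace ℝ (Fin n) →L[ℝ] EuclideanSpace ℝ (Fin n) →L[ℝ] ℝ) x (inner x))

namespace SemiRiemannianMetric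

variable (g : SemiRiemannianMetric n M)

/-- The matrix `g_{ij}(x)` in the coordinate basis at `x`; its inverse is `g^{ij}(x)`. -/
def gram (x : M) : Matrix (Fin n) (Fin n) ℝ :=
  Matrix.of fun i j ↦ g.inner x (frame x i) (frame x j)

/-- The right-hand side of the Koszul formula,
`X g(Y,Z) + Y g(X,Z) - Z g(X,Y) + g([X,Y],Z) - g([X,Z],Y) - g([Y,Z],X)`, at `x`. -/
def koszul (X Y Z : ∀ x : M, TangentSpace (𝓡 n) x) (x : M) : ℝ :=
  mvfderiv (𝓡 n) (fun y ↦ g.inner y (Y y) (Z y)) x (X x)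
    + mvfderiv (𝓡 n) (fun y ↦ g.inner y (X y) (Z y)) x (Y x)
    - mvfderiv (𝓡 n) (fun y ↦ g.inner y (X y) (Y y)) x (Z x)
    + g.inner x (VectorField.mlieBracket (𝓡 n) X Y x) (Z x)
    - g.inner x (VectorField.mlieBracket (𝓡 n) X Z x) (Y x)
    - g.inner x (VectorField.mlieBracket (𝓡 n) Y Z x) (X x)

/-- The Levi-Civita derivative `∇_u Y ∈ T_x M` of a vector field `Y` in the direction
`u ∈ T_x M`: the vector determined by `2 g(∇_u Y, w) = koszul(u, Y, w)`. The formula is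
tensorial in `u` and `w`, which are therefore extended arbitrarily near `x`. -/
def leviCivita (Y : ∀ x : M, TangentSpace (𝓡 n) x) (x : M) (u : TangentSpace (𝓡 n) x) :
    TangentSpace (𝓡 n) x :=
  ∑ k, (∑ l, (g.gram x)⁻¹ k l *
    (g.koszul (FiberBundle.extend (EuclideanSpace ℝ (Fin n)) u) Y
      (FiberBundle.extend (EuclideanSpace ℝ (Fin n)) (frame x l)) x / 2)) • frame x k

/-- A semi-Riemannian volume form of `(M, g)`: a smooth `n`-form taking the values `±1` on
orthonormal bases. Such forms correspond to the orientations of `M`. -/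
structure VolumeForm where
  toFun (x : M) : (TangentSpace (𝓡 n) x) [⋀^Fin n]→ₗ[ℝ] ℝ
  sq_eq (x : M) (v : Fin n → TangentSpace (𝓡 n) x) :
    (toFun x v) ^ 2 = |(Matrix.of fun i j ↦ g.inner x (v i) (v j)).det|
  smooth (X : Fin n → ∀ x : M, TangentSpace (𝓡 n) x) (hX : ∀ i, SmoothField (X i)) :
    ContMDiff (𝓡 n) 𝓘(ℝ) ∞ (fun x ↦ toFun x (fun i ↦ X i x))

end SemiRiemannianMetric

end Geometry

/-! ## Clifford module bundles, connections and Dirac type operators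

`V` is a smooth complex vector bundle over `M` with typical fibre `F`. -/

section Bundles

variable {n : ℕ} {M : Type*} [TopologicalSpace M] [ChartedSpace (EuclideanSpace ℝ (Fin n)) M]
  (F : Type*) [NormedAddCommGroup F] [NormedSpace ℂ F]
  {V : M → Type*} [TopologicalSpace (TotalSpace F V)]
  [∀ x, AddCommGroup (V x)] [∀ x, Module ℂ (V x)] [∀ x, TopologicalSpace (V x)]
  [FiberBundle F V]

/-- Smoothness of a section of `V`. -/
def SmoothSection (s : ∀ x : M, V x) : Prop :=
  ContMDiff (𝓡 n) ((𝓡 n).prod 𝓘(ℝ, F)) ∞ (fun x ↦ TotalSpace.mk' F x (s x))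

/-- A field of fibrewise linear maps is a smooth section of `End(V)`: it maps smooth sections
to smooth sections. -/
def SmoothEnd (φ : ∀ x : M, Module.End ℂ (V x)) : Prop :=
  ∀ s : ∀ x : M, V x, SmoothSection (n := n) F s →
    SmoothSection (n := n) F (fun x ↦ φ x (s x))

variable [IsManifold (𝓡 n) ∞ M]

variable (V) in
/-- A Clifford action of `(T^*M, g)` on `V`, with either sign convention
`γ(α)γ(β) + γ(β)γ(α) = ± 2 g(α, β)`. Covectors are written as `u^♭ = g(u, ·)`. -/
structure CliffordAction (g : SemiRiemannianMetric n M) where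
  sign : ℤˣ
  act (x : M) : (TangentSpace (𝓡 n) x →L[ℝ] ℝ) →ₗ[ℝ] Module.End ℂ (V x)
  clifford (x : M) (u v : TangentSpace (𝓡 n) x) :
    act x (g.inner x u) * act x (g.inner x v) + act x (g.inner x v) * act x (g.inner x u)
      = ((2 * (sign : ℤ) * g.inner x u v : ℝ) : ℂ) • (1 : Module.End ℂ (V x))
  smooth (X : ∀ x : M, TangentSpace (𝓡 n) x) (s : ∀ x : M, V x) :
    SmoothField X → SmoothSection (n := n) F s →
      SmoothSection (n := n) F (fun x ↦ act x (g.inner x (X x)) (s x))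

namespace CliffordAction

variable {F} {g : SemiRiemannianMetric n M} (γ : CliffordAction F V g)

/-- The action `γ(μ) = (1/n!) ∑ μ_{i₁…iₙ} γ(e^{i₁}) ⋯ γ(e^{iₙ})` of the volume form. -/
def volume (μ : g.VolumeForm) (x : M) : Module.End ℂ (V x) :=
  ((n.factorial : ℂ))⁻¹ • ∑ σ : Equiv.Perm (Fin n),
    ((μ.toFun x (fun i ↦ frame x (σ i)) : ℝ) : ℂ) •
      (List.ofFn fun i ↦ γ.act x (coframe x (σ i))).prod

/-- The grading involution `γ_M`: the multiple of `γ(μ)` with square `1`. Here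
`γ(μ)² = (-1)^{n/2 + q}` where `q` is the number of negative directions of `g`, and the sign of
`det (g_{ij})` is `(-1)^q`. -/
def chirality (μ : g.VolumeForm) (x : M) : Module.End ℂ (V x) :=
  (if 0 < (g.gram x).det then Complex.I ^ (n / 2) else Complex.I ^ (n / 2 + 1)) • γ.volume μ x

/-- `φ` belongs to `End_Cl(V) = 1 ⊗ End_Cl(V) ⊆ Cl ⊗ End_Cl(V) = End(V)`. -/
def CommutesWithClifford (φ : ∀ x : M, Module.End ℂ (V x)) : Prop :=
  ∀ (x : M) (α : TangentSpace (𝓡 n) x →L[ℝ] ℝ), Commute (γ.act x α) (φ x)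

/-- `χ` is a smooth involution in `End_Cl(V)`, so that `Γ = γ_M ⊗ χ` is a grading of `V`. -/
structure IsTwistInvolution (χ : ∀ x : M, Module.End ℂ (V x)) : Prop where
  smooth : SmoothEnd (n := n) F χ
  commutes : γ.CommutesWithClifford χ
  sq (x : M) : χ x * χ x = 1

/-- The total grading `Γ = γ_M ⊗ χ`. -/
def grading (μ : g.VolumeForm) (χ : ∀ x : M, Module.End ℂ (V x)) (x : M) :
    Module.End ℂ (V x) :=
  γ.chirality μ x * χ x

/-- `φ` is a section of `End^-_Cl(V)`: smooth, in `End_Cl(V)` and odd with respect to `Γ`. -/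
structure IsOddTwist (μ : g.VolumeForm) (χ φ : ∀ x : M, Module.End ℂ (V x)) : Prop where
  smooth : SmoothEnd (n := n) F φ
  commutes : γ.CommutesWithClifford φ
  odd (x : M) : γ.grading μ χ x * φ x = -(φ x * γ.grading μ χ x)

/-- `D` (used on smooth sections only) is a Dirac type operator: a complex linear operator on
smooth sections with `[D, f] = γ(df)` for all smooth `f`, odd with respect to `Γ`. -/
structure IsDiracType (μ : g.VolumeForm) (χ : ∀ x : M, Module.End ℂ (V x))
    (D : (∀ x : M, V x) → ∀ x : M, V x) : Prop where
  smooth (s : ∀ x : M, V x) : SmoothSection (n := n) F s → SmoothSection (n := n) F (D s)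
  map_add (s t : ∀ x : M, V x) : SmoothSection (n := n) F s → SmoothSection (n := n) F t →
    D (fun x ↦ s x + t x) = fun x ↦ D s x + D t x
  map_smul (c : ℂ) (s : ∀ x : M, V x) : SmoothSection (n := n) F s →
    D (fun x ↦ c • s x) = fun x ↦ c • D s x
  symbol (f : M → ℝ) (s : ∀ x : M, V x) : ContMDiff (𝓡 n) 𝓘(ℝ) ∞ f →
    SmoothSection (n := n) F s →
    D (fun x ↦ f x • s x) = fun x ↦ f x • D s x + γ.act x (mvfderiv (𝓡 n) f x) (s x)
  odd (s : ∀ x : M, V x) : SmoothSection (n := n) F s →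
    D (fun x ↦ γ.grading μ χ x (s x)) = fun x ↦ -(γ.grading μ χ x (D s x))

variable [∀ x, IsTopologicalAddGroup (V x)] [∀ x, ContinuousSMul ℝ (V x)] [VectorBundle ℝ F V]

/-- A smooth connection on the complex vector bundle `V`. -/
structure _root_.SimpleType.IsConnection (A : CovariantDerivative (𝓡 n) F V) : Prop where
  smooth : CovariantDerivative.ContMDiffCovariantDerivative A ∞
  map_smul (c : ℂ) (s : ∀ x : M, V x) : SmoothSection (n := n) F s →
    ∀ (x : M) (u : TangentSpace (𝓡 n) x), A (fun y ↦ c • s y) x u = c • A s x u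

/-- A Clifford connection: `[∇_u, γ(Y^♭)] = γ((∇_u Y)^♭)` with the Levi-Civita derivative of
the vector field `Y` on the right. -/
structure IsCliffordConnection (A : CovariantDerivative (𝓡 n) F V) : Prop where
  isConnection : IsConnection A
  compatible (Y : ∀ x : M, TangentSpace (𝓡 n) x) (s : ∀ x : M, V x) :
    SmoothField Y → SmoothSection (n := n) F s → ∀ (x : M) (u : TangentSpace (𝓡 n) x),
      A (fun y ↦ γ.act y (g.inner y (Y y)) (s y)) x u
        = γ.act x (g.inner x (Y x)) (A s x u) + γ.act x (g.inner x (g.leviCivita Y x u)) (s x)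

/-- The operator `γ ∘ ∇`, i.e. `∑ i, γ(e^i) ∇_{e_i}`. -/
def dirac (A : CovariantDerivative (𝓡 n) F V) (s : ∀ x : M, V x) (x : M) : V x :=
  ∑ i, γ.act x (coframe x i) (A s x (frame x i))

variable (g) in
/-- The second covariant derivative `(∇^{T^*M ⊗ V} ∘ ∇) s` on `u, v ∈ T_x M`, that is
`∇_u ∇_Y s - ∇_{∇_u Y} s` for any extension `Y` of `v` to a vector field near `x`. -/
def _root_.SimpleType.hessian (A : CovariantDerivative (𝓡 n) F V) (s : ∀ x : M, V x) (x : M)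
    (u v : TangentSpace (𝓡 n) x) : V x :=
  A (fun y ↦ A s y (FiberBundle.extend (EuclideanSpace ℝ (Fin n)) v y)) x u
    - A s x (g.leviCivita (FiberBundle.extend (EuclideanSpace ℝ (Fin n)) v) x u)

/-- The Bochner-Laplacian `± tr_g (∇^{T^*M ⊗ V} ∘ ∇)` of a connection; the sign is the one of
the Clifford relation, so that its principal symbol is the one of `D²`. -/
def bochnerLaplacian (A : CovariantDerivative (𝓡 n) F V) (s : ∀ x : M, V x) (x : M) : V x :=
  ((γ.sign : ℤ) : ℝ) •
    ∑ i, ∑ j, (g.gram x)⁻¹ i j • hessian g A s x (frame x i) (frame x j)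

/-- `A` is the connection defining the Bochner-Laplacian of `D`: the operator `D² - △_A` is a
section of `End(V)`. -/
def IsBochnerConnection (D : (∀ x : M, V x) → ∀ x : M, V x)
    (A : CovariantDerivative (𝓡 n) F V) : Prop :=
  IsConnection A ∧ ∃ R : ∀ x : M, Module.End ℂ (V x), SmoothEnd (n := n) F R ∧
    ∀ s : ∀ x : M, V x, SmoothSection (n := n) F s →
      ∀ x, D (D s) x - γ.bochnerLaplacian A s x = R x (s x)

/-- `D` is of simple type: its Bochner-Laplacian is defined by a Clifford connection. -/
def IsSimpleType (D : (∀ x : M, V x) → ∀ x : M, V x) : Prop :=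
  ∃ A : CovariantDerivative (𝓡 n) F V, γ.IsCliffordConnection A ∧ γ.IsBochnerConnection D A

/-- `D = γ ∘ ∇^A + γ_M ⊗ φ`. -/
def IsSum (μ : g.VolumeForm) (D : (∀ x : M, V x) → ∀ x : M, V x)
    (A : CovariantDerivative (𝓡 n) F V) (φ : ∀ x : M, Module.End ℂ (V x)) : Prop :=
  ∀ s : ∀ x : M, V x, SmoothSection (n := n) F s →
    ∀ x, D s x = γ.dirac A s x + γ.chirality μ x (φ x (s x))

/-- The normalized soldering form `Θ(u) = ± γ(u^♭) / n`, a right inverse of `γ`. -/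
def theta (x : M) (u : TangentSpace (𝓡 n) x) : Module.End ℂ (V x) :=
  ((((γ.sign : ℤ) : ℝ) / n : ℝ) : ℂ) • γ.act x (g.inner x u)

/-- The Dirac form of `D` is the `End(V)`-valued one-form `θ`: for the connection `A` defining
the Bochner-Laplacian of `D` one has `Θ ∧ (D - γ ∘ ∇^A) = θ`. -/
def HasDiracForm (D : (∀ x : M, V x) → ∀ x : M, V x)
    (θ : ∀ x : M, TangentSpace (𝓡 n) x → Module.End ℂ (V x)) : Prop :=
  (∃ A : CovariantDerivative (𝓡 n) F V, γ.IsBochnerConnection D A) ∧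
  ∀ A : CovariantDerivative (𝓡 n) F V, γ.IsBochnerConnection D A →
    ∀ s : ∀ x : M, V x, SmoothSection (n := n) F s →
      ∀ (x : M) (u : TangentSpace (𝓡 n) x),
        γ.theta x u (D s x - γ.dirac A s x) = θ x u (s x)

end CliffordAction

end Bundles

end SimpleType

end

/-!
A connection `∇` is the Bochner connection of `D` exactly if
`D ∘ γ(df) + γ(df) ∘ D = 2ε ∇_{grad f} + ε Δf` for all `f`: both sides are what the commutator with
`f` makes of `D²` and of the Bochner-Laplacian. For `D = γ ∘ ∇ + Φ` this says that
`γ(α) Φ + Φ γ(α) + ∑ i, γ(e^i) T(α, e_i) = 0`, where the tensor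
`T(α, u) = [∇_u, γ(α)] - γ(∇_u α)` measures how far `∇` is from a Clifford connection.

If `∇` is a Clifford connection, it is therefore the Bochner connection exactly if `Φ` anticommutes
with the Clifford action, which for even `n` means `Φ = γ_M φ` with `φ` commuting with it.
Conversely, if `Φ` anticommutes with the Clifford action, then `∑ i, γ(e^i) T(α, e_i) = 0`, while
differentiating the Clifford relation shows that `γ(α) T(β, u) + T(β, u) γ(α)` is skew in `α, β`.
Together these say that for each pair of basis vectors a sum of commuting idempotents acts on a
component of `T` by a negative scalar, so that `T = 0`. Finally `Θ` is injective at each point, so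
the Dirac form determines `Φ`.
-/

noncomputable section

namespace SimpleType

/-! ## Clifford families -/

section AnticommutingFamilies

/-- Commuting idempotents are simultaneously diagonalizable with eigenvalues `0` and `1`, so their
sum has no negative eigenvalue. -/
theorem eq_zero_of_sum_idempotents_eq_neg_smul {K ι W : Type*} [Field K] [LinearOrder K]
    [IsStrictOrderedRing K] [AddCommGroup W] [Module K W] (s : Finset ι)
    (P : ι → Module.End K W) (hP : ∀ i, IsIdempotentElem (P i))
    (hcomm : ∀ i j, Commute (P i) (P j)) {c : K} (hc : 0 < c) {w : W}
    (h : ∑ i ∈ s, P i w = -c • w) : w = 0 := by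
  classical
  induction s using Finset.induction_on generalizing c w with
  | empty =>
    rw [Finset.sum_empty, eq_comm, smul_eq_zero] at h
    exact h.resolve_left (neg_ne_zero.2 hc.ne')
  | insert a s ha ih =>
    rw [Finset.sum_insert ha] at h
    have hPa : P a w = 0 := by
      refine ih (add_pos hc one_pos) ?_
      have hPh := congrArg (P a) h
      rw [map_add, ← Module.End.mul_apply, hP a, map_sum, map_smul, ← eq_sub_iff_add_eq'] at hPh
      calc ∑ i ∈ s, P i (P a w) = ∑ i ∈ s, P a (P i w) :=
            Finset.sum_congr rfl fun i _ ↦ LinearMap.congr_fun (hcomm i a) w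
        _ = -(c + 1) • P a w := by rw [hPh]; module
    rw [hPa, zero_add] at h
    exact ih hc h

section Products

variable {A : Type*} [Ring A]

theorem prod_ofFn_swap_of_anticomm {n : ℕ} (f : Fin (n + 1) → A)
    (hf : ∀ i j, i ≠ j → f i * f j = -(f j * f i)) (k : Fin n) :
    (List.ofFn fun i ↦ f (Equiv.swap k.castSucc k.succ i)).prod = -(List.ofFn f).prod := by
  induction n with
  | zero => exact k.elim0
  | succ n ih =>
    induction k using Fin.cases with
    | zero =>
      have hfix (i : Fin n) : Equiv.swap (0 : Fin (n + 2)) 1 i.succ.succ = i.succ.succ :=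
        Equiv.swap_apply_of_ne_of_ne (Fin.succ_ne_zero _) (by simp [Fin.ext_iff])
      simp only [List.ofFn_succ, List.prod_cons, Fin.castSucc_zero, Fin.succ_zero_eq_one', hfix,
        Equiv.swap_apply_left, Equiv.swap_apply_right]
      rw [← mul_assoc, ← mul_assoc, hf 1 0 (by simp), neg_mul]
    | succ k =>
      have hzero : Equiv.swap k.succ.castSucc k.succ.succ (0 : Fin (n + 2)) = 0 :=
        Equiv.swap_apply_of_ne_of_ne (by simp [Fin.ext_iff]) (by simp [Fin.ext_iff])
      have hsucc (i : Fin (n + 1)) : Equiv.swap k.succ.castSucc k.succ.succ i.succ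
          = (Equiv.swap k.castSucc k.succ i).succ := by
        simp only [Equiv.swap_apply_def, ← Fin.succ_castSucc, Fin.succ_inj]
        split_ifs <;> rfl
      rw [List.ofFn_succ, List.ofFn_succ (f := f), List.prod_cons, List.prod_cons, hzero]
      simp_rw [hsucc]
      rw [ih (fun i ↦ f i.succ) (fun i j hij ↦ hf _ _ (by simpa using hij)) k, mul_neg]

theorem prod_ofFn_perm_of_anticomm {n : ℕ} (f : Fin n → A)
    (hf : ∀ i j, i ≠ j → f i * f j = -(f j * f i)) (σ : Equiv.Perm (Fin n)) :
    (List.ofFn fun i ↦ f (σ i)).prod = Equiv.Perm.sign σ • (List.ofFn f).prod := by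
  cases n with
  | zero => simp [Subsingleton.elim σ 1]
  | succ n =>
    have hσ : σ ∈ Submonoid.closure (Set.range fun i : Fin n ↦ Equiv.swap i.castSucc i.succ) :=
      Equiv.Perm.mclosure_swap_castSucc_succ n ▸ Submonoid.mem_top σ
    induction hσ using Submonoid.closure_induction_right with
    | one => simp
    | mul_right σ _ τ hτ ih =>
      obtain ⟨k, rfl⟩ := hτ
      have hswap := prod_ofFn_swap_of_anticomm (fun i ↦ f (σ i))
        (fun i j hij ↦ hf _ _ (by simpa using hij)) k
      simp only [Equiv.Perm.mul_apply]
      rw [hswap, ih, Equiv.Perm.sign_mul, Equiv.Perm.sign_swap (by simp [Fin.ext_iff])]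
      simp

theorem prod_ofFn_mul_of_anticomm {n : ℕ} (f : Fin n → A) (a : A)
    (hf : ∀ i, f i * a = -(a * f i)) :
    (List.ofFn f).prod * a = (-1 : ℤˣ) ^ n • (a * (List.ofFn f).prod) := by
  induction n with
  | zero => simp
  | succ n ih =>
    rw [List.ofFn_succ, List.prod_cons, mul_assoc, ih _ fun i ↦ hf _, mul_smul_comm, ← mul_assoc,
      hf, pow_succ, mul_neg_one, Units.neg_smul, neg_mul, smul_neg, mul_assoc]

theorem mul_prod_ofFn_of_anticomm {n : ℕ} (f : Fin n → A)
    (hf : ∀ i j, i ≠ j → f i * f j = -(f j * f i)) (k : Fin n) :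
    f k * (List.ofFn f).prod = -((-1 : ℤˣ) ^ n • ((List.ofFn f).prod * f k)) := by
  induction n with
  | zero => exact k.elim0
  | succ n ih =>
    rw [List.ofFn_succ, List.prod_cons, pow_succ, mul_neg_one, Units.neg_smul, neg_neg, mul_assoc]
    induction k using Fin.cases with
    | zero =>
      rw [prod_ofFn_mul_of_anticomm _ (f 0) fun i ↦ hf _ _ (Fin.succ_ne_zero _), mul_smul_comm,
        smul_smul, Int.units_mul_self, one_smul]
    | succ k =>
      rw [← mul_assoc, hf _ _ (Fin.succ_ne_zero k), neg_mul, mul_assoc,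
        ih (fun i ↦ f i.succ) (fun i j hij ↦ hf _ _ (by simpa using hij)) k, mul_neg, neg_neg,
        mul_smul_comm]

end Products

/-- Orthogonal generators of a Clifford algebra: pairwise anticommuting elements `γ i` with
`(γ i)² = q i`. -/
structure IsCliffordFamily {K A ι : Type*} [CommRing K] [Ring A] [Algebra K A] (γ : ι → A)
    (q : ι → K) : Prop where
  sq (i : ι) : γ i * γ i = q i • (1 : A)
  anticomm (i j : ι) (hij : i ≠ j) : γ i * γ j = -(γ j * γ i)

namespace IsCliffordFamily

section CommRing

variable {K A : Type*} [CommRing K] [Ring A] [Algebra K A]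

theorem prod_ofFn_mul_self {n : ℕ} {γ : Fin n → A} {q : Fin n → K} (hγ : IsCliffordFamily γ q) :
    (List.ofFn γ).prod * (List.ofFn γ).prod
      = (-1 : ℤˣ) ^ n.choose 2 • (∏ i, q i) • (1 : A) := by
  induction n with
  | zero => simp
  | succ n ih =>
    have htail : IsCliffordFamily (fun i : Fin n ↦ γ i.succ) (fun i ↦ q i.succ) :=
      ⟨fun i ↦ hγ.sq _, fun i j hij ↦ hγ.anticomm _ _ (by simpa using hij)⟩
    rw [List.ofFn_succ, List.prod_cons, Nat.choose_succ_succ' n 1, Nat.choose_one_right, pow_add,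
      Fin.prod_univ_succ, mul_smul, mul_smul]
    set p := (List.ofFn fun i : Fin n ↦ γ i.succ).prod with hp
    calc γ 0 * p * (γ 0 * p) = γ 0 * (p * γ 0) * p := by simp only [mul_assoc]
      _ = (-1 : ℤˣ) ^ n • ((γ 0 * γ 0) * (p * p)) := by
          rw [prod_ofFn_mul_of_anticomm _ (γ 0) fun i ↦ hγ.anticomm _ _ (Fin.succ_ne_zero _), ← hp]
          simp only [mul_smul_comm, smul_mul_assoc, mul_assoc]
      _ = _ := by
          rw [ih htail, hγ.sq, smul_one_mul, smul_comm (q 0)]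

variable {ι : Type*} [DecidableEq ι] {γ : ι → A} {q : ι → K}

theorem mul_add_mul (hγ : IsCliffordFamily γ q) (i j : ι) :
    γ i * γ j + γ j * γ i = if i = j then (2 * q i) • (1 : A) else 0 := by
  split_ifs with h
  · rw [← h, hγ.sq, two_mul, add_smul]
  · rw [hγ.anticomm i j h, neg_add_cancel]

end CommRing

variable {K A ι : Type*} [Field K] [Ring A] [Algebra K A] [Fintype ι] {γ : ι → A} {q : ι → K}

theorem sum_mul_anticomm (hγ : IsCliffordFamily γ q) (hq : ∀ i, q i ≠ 0) {a : ι → A}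
    (ha : ∑ i, (q i)⁻¹ • (γ i * a i) = 0) (j : ι) :
    ∑ i, (q i)⁻¹ • (γ i * (γ j * a i + a i * γ j)) = (2 : K) • a j := by
  classical
  have hterm (i : ι) : (q i)⁻¹ • (γ i * (γ j * a i + a i * γ j))
      = (if i = j then (2 : K) • a j else 0) - γ j * ((q i)⁻¹ • (γ i * a i))
        + ((q i)⁻¹ • (γ i * a i)) * γ j := by
    rw [mul_add, ← mul_assoc, eq_sub_of_add_eq (hγ.mul_add_mul i j), ← mul_assoc, smul_add,
      sub_mul, smul_sub, mul_smul_comm, mul_assoc (γ j), smul_mul_assoc]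
    congr 2
    split_ifs with h
    · rw [← h, smul_mul_assoc, one_mul, smul_smul, mul_left_comm, inv_mul_cancel₀ (hq i), mul_one]
    · simp
  simp only [hterm, Finset.sum_add_distrib, Finset.sum_sub_distrib, ← Finset.mul_sum,
    ← Finset.sum_mul, ha]
  simp

variable [LinearOrder K] [IsStrictOrderedRing K]

/-- The maps `a ↦ (2 q i)⁻¹ γ i (γ i a + a γ i)` are commuting idempotents. -/
theorem eq_zero_of_sum_mul_anticomm_eq_neg_smul (hγ : IsCliffordFamily γ q) (hq : ∀ i, q i ≠ 0)
    {c : K} (hc : 0 < c) {a : A}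
    (ha : ∑ i, (q i)⁻¹ • (γ i * (γ i * a + a * γ i)) = -c • a) : a = 0 := by
  let conj (i : ι) : Module.End K A := (q i)⁻¹ • LinearMap.mulLeftRight K (γ i, γ i)
  have conj_apply (i : ι) (w : A) : conj i w = (q i)⁻¹ • (γ i * w * γ i) := rfl
  have conj_sq (i : ι) : conj i * conj i = 1 := by
    ext w
    calc conj i (conj i w) = ((q i)⁻¹ * (q i)⁻¹) • ((γ i * γ i) * w * (γ i * γ i)) := by
          simp only [conj_apply, mul_smul_comm, smul_mul_assoc, smul_smul, mul_assoc]
      _ = w := by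
          have := hq i
          simp only [hγ.sq, mul_smul_comm, smul_mul_assoc, smul_smul, mul_one, one_mul]
          rw [show (q i)⁻¹ * (q i)⁻¹ * (q i * q i) = 1 by field_simp, one_smul]
  have conj_comm (i j : ι) : Commute (conj i) (conj j) := by
    obtain rfl | hij := eq_or_ne i j
    · exact Commute.refl _
    refine LinearMap.ext fun w ↦ ?_
    have hconj (k l : ι) : conj k (conj l w)
        = ((q k)⁻¹ * (q l)⁻¹) • ((γ k * γ l) * w * (γ l * γ k)) := by
      simp only [conj_apply, mul_smul_comm, smul_mul_assoc, smul_smul, mul_assoc]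
    rw [Module.End.mul_apply, Module.End.mul_apply, hconj, hconj, hγ.anticomm i j hij,
      hγ.anticomm j i hij.symm, mul_comm (q i)⁻¹]
    simp only [hγ.anticomm i j hij, neg_mul, mul_neg, neg_neg]
  refine eq_zero_of_sum_idempotents_eq_neg_smul Finset.univ (fun i ↦ (2 : K)⁻¹ • (1 + conj i))
    (fun i ↦ ?_) (fun i j ↦ ?_) (half_pos hc) ?_
  · rw [IsIdempotentElem, smul_mul_smul_comm, mul_add, add_mul, add_mul, conj_sq]
    simp only [mul_one, one_mul]
    module
  · exact ((((Commute.one_left _).add_left ((Commute.one_right _).add_right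
      (conj_comm i j)) : Commute _ _)).smul_left _).smul_right _
  · have hproj (i : ι) : ((2 : K)⁻¹ • (1 + conj i)) a
        = (2 : K)⁻¹ • ((q i)⁻¹ • (γ i * (γ i * a + a * γ i))) := by
      change (2 : K)⁻¹ • (a + conj i a) = _
      rw [conj_apply, mul_add, ← mul_assoc, hγ.sq, ← mul_assoc, smul_mul_assoc, one_mul,
        smul_add (q i)⁻¹, inv_smul_smul₀ (hq i)]
    simp only [hproj, ← Finset.smul_sum, ha]
    module

/-- The hypotheses make `γ i T j k + T j k γ i` antisymmetric in all three indices, so that its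
contraction is a negative multiple of `T j k`. -/
theorem eq_zero_of_contraction_eq_zero (hγ : IsCliffordFamily γ q) (hq : ∀ i, q i ≠ 0)
    {T : ι → ι → A} (hcontr : ∀ k, ∑ i, (q i)⁻¹ • (γ i * T i k) = 0)
    (hskew : ∀ i j k, γ j * T i k + T i k * γ j = -(γ k * T i j + T i j * γ k)) (j k : ι) :
    T j k = 0 := by
  have hT (j k : ι) : T j k = -T k j := by
    refine smul_right_injective A (two_ne_zero (α := K)) ?_
    simp only [smul_neg, ← hγ.sum_mul_anticomm hq (hcontr _), hskew _ j k, mul_neg,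
      Finset.sum_neg_distrib]
  have hcycle (i j k : ι) : γ i * T j k + T j k * γ i = -(γ j * T i k + T i k * γ j) := by
    rw [hskew j i k, hT j i, ← neg_eq_iff_eq_neg.2 (hskew i k j)]
    noncomm_ring
  refine hγ.eq_zero_of_sum_mul_anticomm_eq_neg_smul hq two_pos ?_
  simp only [hcycle _ j k, mul_neg, smul_neg, Finset.sum_neg_distrib,
    hγ.sum_mul_anticomm hq (hcontr k), neg_smul]

end IsCliffordFamily

end AnticommutingFamilies

/-! ## Smooth sections and tensoriality -/

section SmoothSections

open Filter
open scoped Topology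

variable {n : ℕ} {M : Type*} [TopologicalSpace M] [ChartedSpace (EuclideanSpace ℝ (Fin n)) M]

section Cutoff

variable [IsManifold (𝓡 n) ∞ M] [T2Space M]

theorem exists_contMDiff_tsupport_subset_eventuallyEq_one (x : M) {u : Set M} (hu : u ∈ 𝓝 x) :
    ∃ ψ : M → ℝ, ContMDiff (𝓡 n) 𝓘(ℝ) ∞ ψ ∧ tsupport ψ ⊆ u ∧ ψ =ᶠ[𝓝 x] 1 := by
  obtain ⟨ψ, -, hψ⟩ := (SmoothBumpFunction.nhds_basis_tsupport (I := 𝓡 n) x).mem_iff.1 hu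
  exact ⟨ψ, ψ.contMDiff, hψ, ψ.eventuallyEq_one⟩

theorem exists_contMDiff_eventuallyEq (x : M) {h : M → ℝ} {u : Set M} (hu : u ∈ 𝓝 x)
    (hh : ∀ y ∈ u, ContMDiffAt (𝓡 n) 𝓘(ℝ) ∞ h y) :
    ∃ f : M → ℝ, ContMDiff (𝓡 n) 𝓘(ℝ) ∞ f ∧ f =ᶠ[𝓝 x] h := by
  obtain ⟨ψ, hψ, hsupp, hone⟩ := exists_contMDiff_tsupport_subset_eventuallyEq_one (n := n) x hu
  refine ⟨fun y ↦ ψ y * h y, contMDiff_of_tsupport fun y hy ↦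
    hψ.contMDiffAt.mul (hh y (hsupp (tsupport_mul_subset_left hy))), ?_⟩
  filter_upwards [hone] with y hy
  rw [hy, Pi.one_apply, one_mul]

theorem exists_contMDiff_mvfderiv_eq (x : M) (α : TangentSpace (𝓡 n) x →L[ℝ] ℝ) :
    ∃ f : M → ℝ, ContMDiff (𝓡 n) 𝓘(ℝ) ∞ f ∧ mvfderiv (𝓡 n) f x = α := by
  let β : EuclideanSpace ℝ (Fin n) →L[ℝ] ℝ := α
  let h : M → ℝ := fun y ↦ β (extChartAt (𝓡 n) x y)
  have hh (y : M) (hy : y ∈ (chartAt (EuclideanSpace ℝ (Fin n)) x).source) :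
      ContMDiffAt (𝓡 n) 𝓘(ℝ) ∞ h y :=
    β.contMDiff.contMDiffAt.comp y (contMDiffAt_extChartAt' hy)
  obtain ⟨f, hf, hfh⟩ := exists_contMDiff_eventuallyEq x
    ((chartAt (EuclideanSpace ℝ (Fin n)) x).open_source.mem_nhds (mem_chart_source _ x)) hh
  have hwritten : writtenInExtChartAt (𝓡 n) 𝓘(ℝ) x h =ᶠ[𝓝 (extChartAt (𝓡 n) x x)] β := by
    filter_upwards [extChartAt_target_mem_nhds (I := 𝓡 n) x] with y hy
    simp only [writtenInExtChartAt, h, Function.comp_apply, extChartAt_model_space_eq_id]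
    rw [(extChartAt (𝓡 n) x).right_inv hy]
    rfl
  have hderiv : HasMFDerivAt (𝓡 n) 𝓘(ℝ) h x β :=
    ⟨(hh x (mem_chart_source _ x)).continuousAt,
      (β.hasFDerivAt.congr_of_eventuallyEq hwritten).hasFDerivWithinAt⟩
  refine ⟨f, hf, ContinuousLinearMap.ext fun v ↦ ?_⟩
  simp only [mvfderiv, hfh.mfderiv_eq, hderiv.mfderiv]
  rfl

end Cutoff

variable (F : Type*) [NormedAddCommGroup F] [NormedSpace ℝ F]
  {V : M → Type*} [TopologicalSpace (TotalSpace F V)]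
  [∀ x, AddCommGroup (V x)] [∀ x, Module ℝ (V x)] [∀ x, TopologicalSpace (V x)]
  [FiberBundle F V]

/-- `P` is tensorial at `x` as an operation on globally defined smooth sections. Unlike Mathlib's
`TensorialAt` nothing is required of sections that are only differentiable at `x`: differential
operators are only meaningful on smooth sections. -/
structure IsTensorialAt {W : Type*} [AddCommGroup W] [Module ℝ W] (x : M)
    (P : (∀ y, V y) → W) : Prop where
  add (s t : ∀ y, V y) :
    ContMDiff (𝓡 n) ((𝓡 n).prod 𝓘(ℝ, F)) ∞ (fun y ↦ TotalSpace.mk' F y (s y)) →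
    ContMDiff (𝓡 n) ((𝓡 n).prod 𝓘(ℝ, F)) ∞ (fun y ↦ TotalSpace.mk' F y (t y)) →
    P (fun y ↦ s y + t y) = P s + P t
  smul (f : M → ℝ) (s : ∀ y, V y) : ContMDiff (𝓡 n) 𝓘(ℝ) ∞ f →
    ContMDiff (𝓡 n) ((𝓡 n).prod 𝓘(ℝ, F)) ∞ (fun y ↦ TotalSpace.mk' F y (s y)) →
    P (fun y ↦ f y • s y) = f x • P s

variable {F} [IsManifold (𝓡 n) ∞ M] [T2Space M] [VectorBundle ℝ F V]

theorem exists_contMDiff_section_eventuallyEq (x : M) (s : ∀ y, V y) {u : Set M} (hu : u ∈ 𝓝 x)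
    (hs : ContMDiffOn (𝓡 n) ((𝓡 n).prod 𝓘(ℝ, F)) ∞ (fun y ↦ TotalSpace.mk' F y (s y)) u) :
    ∃ t : ∀ y, V y,
      ContMDiff (𝓡 n) ((𝓡 n).prod 𝓘(ℝ, F)) ∞ (fun y ↦ TotalSpace.mk' F y (t y)) ∧
      ∀ᶠ y in 𝓝 x, t y = s y := by
  obtain ⟨ψ, hψ, hsupp, hone⟩ :=
    exists_contMDiff_tsupport_subset_eventuallyEq_one (n := n) x (interior_mem_nhds.2 hu)
  refine ⟨ψ • s, hψ.contMDiffOn.smul_section_of_tsupport isOpen_interior hsupp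
    (hs.mono interior_subset), ?_⟩
  filter_upwards [hone] with y hy
  rw [Pi.smul_apply', hy, Pi.one_apply, one_smul]

variable [ContMDiffVectorBundle ∞ F V (𝓡 n)]

theorem exists_contMDiff_section_eventuallyEq_extend (x : M) (v : V x) :
    ∃ t : ∀ y, V y,
      ContMDiff (𝓡 n) ((𝓡 n).prod 𝓘(ℝ, F)) ∞ (fun y ↦ TotalSpace.mk' F y (t y)) ∧
      (∀ᶠ y in 𝓝 x, t y = FiberBundle.extend F v y) ∧ t x = v := by
  obtain ⟨u, hu, hs⟩ := FiberBundle.exists_contMDiffOn_extend (k := ∞) (𝓡 n) F v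
  obtain ⟨t, ht, h⟩ := exists_contMDiff_section_eventuallyEq x _ hu hs
  exact ⟨t, ht, h, by simpa using h.self_of_nhds⟩

/-- With a cutoff function `ψ` and a local frame `E`, one has
`s = (1 - ψ²) s + ∑ i, (ψ sⁱ) (ψ E i)`. -/
theorem exists_eq_sum_smul_of_apply_eq_zero [FiniteDimensional ℝ F] (x : M) (s : ∀ y, V y)
    (hs : ContMDiff (𝓡 n) ((𝓡 n).prod 𝓘(ℝ, F)) ∞ (fun y ↦ TotalSpace.mk' F y (s y)))
    (hx : s x = 0) :
    ∃ (m : ℕ) (f : Fin m → M → ℝ) (t : Fin m → ∀ y, V y),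
      (∀ i, ContMDiff (𝓡 n) 𝓘(ℝ) ∞ (f i)) ∧
      (∀ i, ContMDiff (𝓡 n) ((𝓡 n).prod 𝓘(ℝ, F)) ∞ (fun y ↦ TotalSpace.mk' F y (t i y))) ∧
      (∀ i, f i x = 0) ∧ s = fun y ↦ ∑ i, f i y • t i y := by
  let e := trivializationAt F V x
  let b := Module.finBasis ℝ F
  obtain ⟨ψ, hψ, hsupp, hone⟩ := exists_contMDiff_tsupport_subset_eventuallyEq_one (n := n) x
    (e.open_baseSet.mem_nhds (FiberBundle.mem_baseSet_trivializationAt F V x))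
  let E (i : Fin (Module.finrank ℝ F)) (y : M) : V y := ψ y • e.localFrame b i y
  let c (i : Fin (Module.finrank ℝ F)) (y : M) : ℝ := ψ y * e.localFrameCoeff (𝓡 n) b i y (s y)
  have hE (i) : ContMDiff (𝓡 n) ((𝓡 n).prod 𝓘(ℝ, F)) ∞ (fun y ↦ TotalSpace.mk' F y (E i y)) :=
    hψ.contMDiffOn.smul_section_of_tsupport e.open_baseSet hsupp
      (e.contMDiffOn_localFrame_baseSet ∞ b i)
  have hc (i) : ContMDiff (𝓡 n) 𝓘(ℝ) ∞ (c i) := contMDiff_of_tsupport fun y hy ↦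
    hψ.contMDiffAt.mul
      (contMDiffAt_localFrameCoeff b (hsupp (tsupport_mul_subset_left hy)) (hs y) i)
  have hsum (y : M) : ∑ i, c i y • E i y = (ψ y * ψ y) • s y := by
    by_cases hy : y ∈ e.baseSet
    · conv_rhs => rw [e.eq_sum_localFrameCoeff_smul (I := 𝓡 n) (s := s) (b := b) hy]
      simp only [c, E, smul_smul, Finset.smul_sum, mul_right_comm]
    · have hψy : ψ y = 0 := image_eq_zero_of_notMem_tsupport fun h ↦ hy (hsupp h)
      simp only [c, E, hψy, zero_mul, zero_smul, Finset.sum_const_zero]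
  refine ⟨_, Fin.cons (fun y ↦ 1 - ψ y * ψ y) c, Fin.cons s E,
    Fin.forall_fin_succ.2 ⟨contMDiff_const.sub (hψ.mul hψ), hc⟩,
    Fin.forall_fin_succ.2 ⟨hs, hE⟩, Fin.forall_fin_succ.2 ⟨?_, fun i ↦ ?_⟩, funext fun y ↦ ?_⟩
  · simp [hone.self_of_nhds]
  · simp [c, hx]
  · simp only [Fin.sum_univ_succ, Fin.cons_zero, Fin.cons_succ, hsum]
    module

namespace IsTensorialAt

variable {W : Type*} [AddCommGroup W] [Module ℝ W] {x : M} {P : (∀ y, V y) → W}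

omit [T2Space M] [ContMDiffVectorBundle ∞ F V (𝓡 n)] [IsManifold (𝓡 n) ∞ M] in
theorem sum (hP : IsTensorialAt (n := n) F x P) {ι : Type*} (I : Finset ι) (t : ι → ∀ y, V y)
    (ht : ∀ i, ContMDiff (𝓡 n) ((𝓡 n).prod 𝓘(ℝ, F)) ∞ (fun y ↦ TotalSpace.mk' F y (t i y))) :
    P (fun y ↦ ∑ i ∈ I, t i y) = ∑ i ∈ I, P (t i) := by
  classical
  induction I using Finset.induction_on with
  | empty =>
    have hzero := hP.smul (fun _ ↦ 0) (fun y ↦ (0 : V y)) contMDiff_const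
      ((contMDiff_zeroSection ℝ V).of_le le_top)
    simpa using hzero
  | insert a I ha ih =>
    simp only [Finset.sum_insert ha]
    rw [hP.add _ _ (ht a) (ContMDiff.sum_section fun i _ ↦ ht i), ih]

variable [FiniteDimensional ℝ F]

theorem eq_zero_of_apply_eq_zero (hP : IsTensorialAt (n := n) F x P) {s : ∀ y, V y}
    (hs : ContMDiff (𝓡 n) ((𝓡 n).prod 𝓘(ℝ, F)) ∞ (fun y ↦ TotalSpace.mk' F y (s y)))
    (hx : s x = 0) : P s = 0 := by
  obtain ⟨m, f, t, hf, ht, hfx, rfl⟩ := exists_eq_sum_smul_of_apply_eq_zero x s hs hx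
  rw [hP.sum _ (fun i y ↦ f i y • t i y) fun i ↦ (hf i).smul_section (ht i)]
  exact Finset.sum_eq_zero fun i _ ↦ by rw [hP.smul _ _ (hf i) (ht i), hfx, zero_smul]

theorem congr (hP : IsTensorialAt (n := n) F x P) {s t : ∀ y, V y}
    (hs : ContMDiff (𝓡 n) ((𝓡 n).prod 𝓘(ℝ, F)) ∞ (fun y ↦ TotalSpace.mk' F y (s y)))
    (ht : ContMDiff (𝓡 n) ((𝓡 n).prod 𝓘(ℝ, F)) ∞ (fun y ↦ TotalSpace.mk' F y (t y)))
    (hst : s x = t x) : P s = P t := by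
  have hadd := hP.add t (s - t) ht (hs.sub_section ht)
  rw [hP.eq_zero_of_apply_eq_zero (hs.sub_section ht) (sub_eq_zero.2 hst), add_zero] at hadd
  simpa only [Pi.sub_apply, add_sub_cancel] using hadd

theorem exists_linearMap (hP : IsTensorialAt (n := n) F x P) :
    ∃ L : V x →ₗ[ℝ] W, ∀ s : ∀ y, V y,
      ContMDiff (𝓡 n) ((𝓡 n).prod 𝓘(ℝ, F)) ∞ (fun y ↦ TotalSpace.mk' F y (s y)) →
      P s = L (s x) := by
  choose E hE _ hEx using exists_contMDiff_section_eventuallyEq_extend (n := n) (F := F) (V := V) x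
  refine ⟨{ toFun := fun u ↦ P (E u), map_add' := fun u v ↦ ?_, map_smul' := fun c u ↦ ?_ },
    fun s hs ↦ hP.congr hs (hE _) (hEx _).symm⟩
  · rw [← hP.add _ _ (hE u) (hE v)]
    exact hP.congr (hE _) ((hE u).add_section (hE v)) (by simp only [hEx])
  · rw [RingHom.id_apply, ← hP.smul (fun _ ↦ c) _ contMDiff_const (hE u)]
    exact hP.congr (hE _) (contMDiff_const.smul_section (hE u)) (by simp only [hEx])

end IsTensorialAt

end SmoothSections

/-! ## Semi-Riemannian metrics -/

section Metric

variable {n : ℕ} {M : Type*} [TopologicalSpace M] [ChartedSpace (EuclideanSpace ℝ (Fin n)) M]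

instance (x : M) : FiniteDimensional ℝ (TangentSpace (𝓡 n) x) :=
  inferInstanceAs (FiniteDimensional ℝ (EuclideanSpace ℝ (Fin n)))

/-- The coordinate basis `frame x` of `T_x M` as a bundled basis. -/
def frameBasis (x : M) : Module.Basis (Fin n) ℝ (TangentSpace (𝓡 n) x) :=
  (EuclideanSpace.basisFun (Fin n) ℝ).toBasis

theorem coe_frameBasis (x : M) : ⇑(frameBasis (n := n) x) = frame x :=
  funext fun i ↦ by
    change (EuclideanSpace.basisFun (Fin n) ℝ).toBasis i = _
    rw [OrthonormalBasis.coe_toBasis, EuclideanSpace.basisFun_apply, frame]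

theorem coframe_apply_eq_repr (x : M) (i : Fin n) (u : TangentSpace (𝓡 n) x) :
    coframe x i u = (frameBasis x).repr u i := by
  have h (v : EuclideanSpace ℝ (Fin n)) :
      v i = (EuclideanSpace.basisFun (Fin n) ℝ).toBasis.repr v i := by simp
  exact h u

variable [IsManifold (𝓡 n) ∞ M]

namespace SemiRiemannianMetric

variable (g : SemiRiemannianMetric n M) {x : M}

/-- The Gram matrix of a family of tangent vectors. -/
def gramOf (b : Fin n → TangentSpace (𝓡 n) x) : Matrix (Fin n) (Fin n) ℝ :=
  Matrix.of fun i j ↦ g.inner x (b i) (b j)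

theorem gramOf_frame (x : M) : g.gramOf (frame x) = g.gram x := rfl

variable (x) in
/-- The metric on `T_x M` as a bilinear form. -/
def form : LinearMap.BilinForm ℝ (TangentSpace (𝓡 n) x) :=
  LinearMap.mk₂ ℝ (fun u v ↦ g.inner x u v) (by simp) (by simp) (by simp) (by simp)

theorem form_apply (u v : TangentSpace (𝓡 n) x) : g.form x u v = g.inner x u v := rfl

theorem form_nondegenerate : (g.form x).Nondegenerate :=
  ⟨fun u h ↦ g.nondegenerate x u h,
    fun u h ↦ g.nondegenerate x u fun v ↦ (g.symm x u v).trans (h v)⟩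

theorem ext_inner {u v : TangentSpace (𝓡 n) x} (h : ∀ w, g.inner x u w = g.inner x v w) :
    u = v :=
  sub_eq_zero.1 (g.nondegenerate x _ fun w ↦ by simp [h w])

theorem gramOf_eq_toMatrix (b : Module.Basis (Fin n) ℝ (TangentSpace (𝓡 n) x)) :
    g.gramOf b = LinearMap.BilinForm.toMatrix b (g.form x) := by
  ext i j
  simp [gramOf, form_apply]

theorem det_gramOf_ne_zero (b : Module.Basis (Fin n) ℝ (TangentSpace (𝓡 n) x)) :
    (g.gramOf b).det ≠ 0 := by
  rw [gramOf_eq_toMatrix]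
  exact (LinearMap.BilinForm.nondegenerate_iff_det_ne_zero b).1 g.form_nondegenerate

theorem det_gram_ne_zero (x : M) : (g.gram x).det ≠ 0 := by
  simpa only [coe_frameBasis, gramOf_frame] using g.det_gramOf_ne_zero (frameBasis x)

theorem exists_basis_of_det_gramOf_ne_zero (b : Fin n → TangentSpace (𝓡 n) x)
    (h : (g.gramOf b).det ≠ 0) :
    ∃ b' : Module.Basis (Fin n) ℝ (TangentSpace (𝓡 n) x), ⇑b' = b := by
  have hli : LinearIndependent ℝ b := by
    rw [Fintype.linearIndependent_iff]
    intro c hc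
    refine congrFun (Matrix.eq_zero_of_vecMul_eq_zero h (funext fun j ↦ ?_))
    have hj : g.inner x (∑ i, c i • b i) (b j) = 0 := by rw [hc, map_zero, zero_apply]
    simpa [Matrix.vecMul, dotProduct, gramOf] using hj
  have hcard : Fintype.card (Fin n) = Module.finrank ℝ (TangentSpace (𝓡 n) x) :=
    (Module.finrank_eq_card_basis (frameBasis x)).symm
  exact ⟨.mk hli (hli.span_eq_top_of_card_eq_finrank' hcard).ge, Module.Basis.coe_mk _ _⟩

section Reciprocal

variable (b : Module.Basis (Fin n) ℝ (TangentSpace (𝓡 n) x))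

/-- The reciprocal basis `b^i = g^{ij} b_j` of `T_x M`, the metric dual of the dual basis. -/
def reciprocal (i : Fin n) : TangentSpace (𝓡 n) x :=
  ∑ j, (g.gramOf b)⁻¹ i j • b j

theorem inner_reciprocal (i : Fin n) (w : TangentSpace (𝓡 n) x) :
    g.inner x (g.reciprocal b i) w = b.repr w i := by
  have hb (k : Fin n) : g.inner x (g.reciprocal b i) (b k) = (1 : Matrix _ _ ℝ) i k := by
    rw [← Matrix.nonsing_inv_mul _ (g.det_gramOf_ne_zero b).isUnit, Matrix.mul_apply]
    simp [reciprocal, gramOf]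
  conv_lhs => rw [← b.sum_repr w, map_sum]
  simp [hb, Matrix.one_apply]

theorem sum_inner_smul_reciprocal (w : TangentSpace (𝓡 n) x) :
    ∑ i, g.inner x (b i) w • g.reciprocal b i = w := by
  refine g.ext_inner fun v ↦ ?_
  conv_rhs => rw [g.symm, ← b.sum_repr v, map_sum]
  simp [inner_reciprocal, mul_comm]

theorem sum_inner_reciprocal_smul (w : TangentSpace (𝓡 n) x) :
    ∑ i, g.inner x (g.reciprocal b i) w • b i = w := by
  simp only [inner_reciprocal, b.sum_repr]

theorem coframe_eq_inner_reciprocal (x : M) (i : Fin n) :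
    coframe x i = g.inner x (g.reciprocal (frameBasis x) i) :=
  ContinuousLinearMap.ext fun u ↦ by rw [inner_reciprocal, coframe_apply_eq_repr]

variable {W : Type*} [AddCommGroup W] [Module ℝ W]
  (B : TangentSpace (𝓡 n) x →ₗ[ℝ] TangentSpace (𝓡 n) x →ₗ[ℝ] W)

theorem sum_apply_reciprocal_eq_sum_apply_reciprocal
    (c : Module.Basis (Fin n) ℝ (TangentSpace (𝓡 n) x)) :
    ∑ i, B (b i) (g.reciprocal b i) = ∑ k, B (c k) (g.reciprocal c k) := by
  calc ∑ i, B (b i) (g.reciprocal b i)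
      = ∑ i, ∑ k, g.inner x (g.reciprocal c k) (b i) • B (c k) (g.reciprocal b i) :=
        Finset.sum_congr rfl fun i _ ↦ by
          conv_lhs => rw [← g.sum_inner_reciprocal_smul c (b i)]
          simp only [map_sum, map_smul, LinearMap.sum_apply, LinearMap.smul_apply]
    _ = ∑ k, B (c k) (∑ i, g.inner x (b i) (g.reciprocal c k) • g.reciprocal b i) := by
        rw [Finset.sum_comm]
        simp only [map_sum, map_smul, g.symm x (b _)]
    _ = ∑ k, B (c k) (g.reciprocal c k) := by simp only [sum_inner_smul_reciprocal]

variable (x) in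
/-- The metric contraction `∑ g^{ij} B(e_i, e_j)` of a bilinear map on `T_x M`. -/
def contract : W :=
  ∑ i, ∑ j, (g.gram x)⁻¹ i j • B (frame x i) (frame x j)

theorem contract_eq_sum_apply_reciprocal :
    g.contract x B = ∑ i, B (b i) (g.reciprocal b i) := by
  rw [g.sum_apply_reciprocal_eq_sum_apply_reciprocal b B (frameBasis x)]
  simp only [contract, reciprocal, coe_frameBasis, gramOf_frame, map_sum, map_smul]

theorem contract_eq_sum_gramOf :
    g.contract x B = ∑ i, ∑ j, (g.gramOf b)⁻¹ i j • B (b i) (b j) := by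
  simp only [g.contract_eq_sum_apply_reciprocal b, reciprocal, map_sum, map_smul]

theorem contract_eq_apply_of_eq_inner_smul (w : TangentSpace (𝓡 n) x)
    (a : TangentSpace (𝓡 n) x →ₗ[ℝ] W) (hB : ∀ u v, B u v = g.inner x u w • a v) :
    g.contract x B = a w := by
  rw [g.contract_eq_sum_apply_reciprocal (frameBasis x)]
  conv_rhs => rw [← g.sum_inner_smul_reciprocal (frameBasis x) w]
  simp only [hB, map_sum, map_smul]

end Reciprocal

/-- `e` is an orthogonal basis of `T_x M` with `g(e_i, e_i) = d_i ≠ 0`. -/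
structure IsOrthogonal (e : Module.Basis (Fin n) ℝ (TangentSpace (𝓡 n) x)) (d : Fin n → ℝ) :
    Prop where
  ne_zero (i : Fin n) : d i ≠ 0
  inner_eq (i j : Fin n) : g.inner x (e i) (e j) = if i = j then d i else 0

variable (x) in
theorem exists_isOrthogonal :
    ∃ (e : Module.Basis (Fin n) ℝ (TangentSpace (𝓡 n) x)) (d : Fin n → ℝ),
      g.IsOrthogonal e d := by
  have hfin : Module.finrank ℝ (TangentSpace (𝓡 n) x) = n := by
    rw [Module.finrank_eq_card_basis (frameBasis x), Fintype.card_fin]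
  obtain ⟨v, hv⟩ :=
    LinearMap.BilinForm.exists_orthogonal_basis (B := g.form x) ⟨fun u w ↦ g.symm x u w⟩
  let e := v.reindex (finCongr hfin)
  have he (i j : Fin n) :
      g.inner x (e i) (e j) = if i = j then g.inner x (e i) (e i) else 0 := by
    split_ifs with hij
    · rw [hij]
    · simpa [e, form_apply] using
        hv (i := (finCongr hfin).symm i) (j := (finCongr hfin).symm j) (by simpa using hij)
  refine ⟨e, fun i ↦ g.inner x (e i) (e i), fun i hi ↦ ?_, he⟩
  refine g.det_gramOf_ne_zero e (Matrix.det_eq_zero_of_row_eq_zero i fun j ↦ ?_)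
  rw [gramOf, Matrix.of_apply, he i j, hi, ite_self]

namespace IsOrthogonal

variable {g} {e : Module.Basis (Fin n) ℝ (TangentSpace (𝓡 n) x)} {d : Fin n → ℝ}
  (he : g.IsOrthogonal e d)

include he

theorem gramOf_eq : g.gramOf e = Matrix.diagonal d := by
  ext i j
  rw [gramOf, Matrix.of_apply, he.inner_eq, Matrix.diagonal_apply]

theorem reciprocal_eq (i : Fin n) : g.reciprocal e i = (d i)⁻¹ • e i := by
  have hinv : (g.gramOf e)⁻¹ = Matrix.diagonal d⁻¹ := by
    rw [he.gramOf_eq]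
    refine Matrix.inv_eq_right_inv ?_
    simp [he.ne_zero]
  simp [reciprocal, hinv, Matrix.diagonal_apply]

theorem eq_sum (w : TangentSpace (𝓡 n) x) :
    w = ∑ i, ((d i)⁻¹ * g.inner x (e i) w) • e i := by
  conv_lhs => rw [← g.sum_inner_smul_reciprocal e w]
  simp only [he.reciprocal_eq, smul_smul, mul_comm]

theorem contract_eq {W : Type*} [AddCommGroup W] [Module ℝ W]
    (B : TangentSpace (𝓡 n) x →ₗ[ℝ] TangentSpace (𝓡 n) x →ₗ[ℝ] W) :
    g.contract x B = ∑ i, (d i)⁻¹ • B (e i) (e i) := by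
  simp only [g.contract_eq_sum_apply_reciprocal e, he.reciprocal_eq, map_smul]

end IsOrthogonal

/-- The vector `α^♯` metrically dual to a covector `α`. -/
def sharp (α : TangentSpace (𝓡 n) x →L[ℝ] ℝ) : TangentSpace (𝓡 n) x :=
  ((g.form x).toDual g.form_nondegenerate).symm α

theorem inner_sharp (α : TangentSpace (𝓡 n) x →L[ℝ] ℝ) : g.inner x (g.sharp α) = α :=
  ContinuousLinearMap.ext fun v ↦
    LinearMap.BilinForm.apply_toDual_symm_apply (hB := g.form_nondegenerate) _ v

/-- The gradient of a function. -/
def grad (f : M → ℝ) (x : M) : TangentSpace (𝓡 n) x :=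
  g.sharp (mvfderiv (𝓡 n) f x)

theorem inner_grad (f : M → ℝ) (x : M) : g.inner x (g.grad f x) = mvfderiv (𝓡 n) f x :=
  g.inner_sharp _

end SemiRiemannianMetric

end Metric

section MetricSmoothness

open Filter
open scoped Topology

variable {n : ℕ} {M : Type*} [TopologicalSpace M] [ChartedSpace (EuclideanSpace ℝ (Fin n)) M]
  {x : M}

theorem contMDiffAt_matrix_det {m : ℕ} {G : M → Matrix (Fin m) (Fin m) ℝ}
    (hG : ∀ i j, ContMDiffAt (𝓡 n) 𝓘(ℝ) ∞ (fun y ↦ G y i j) x) :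
    ContMDiffAt (𝓡 n) 𝓘(ℝ) ∞ (fun y ↦ (G y).det) x := by
  simp only [Matrix.det_apply']
  exact contMDiffAt_finsetSum fun σ _ ↦ contMDiffAt_const.mul
    (contMDiffAt_finsetProd fun i _ ↦ hG _ _)

theorem contMDiffAt_matrix_inv_apply {m : ℕ} {G : M → Matrix (Fin m) (Fin m) ℝ}
    (hG : ∀ i j, ContMDiffAt (𝓡 n) 𝓘(ℝ) ∞ (fun y ↦ G y i j) x) (hx : (G x).det ≠ 0)
    (i j : Fin m) : ContMDiffAt (𝓡 n) 𝓘(ℝ) ∞ (fun y ↦ (G y)⁻¹ i j) x := by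
  simp only [Matrix.inv_def, Matrix.smul_apply, Ring.inverse_eq_inv', smul_eq_mul,
    Matrix.adjugate_apply]
  refine ((contMDiffAt_matrix_det hG).inv₀ hx).mul (contMDiffAt_matrix_det fun k l ↦ ?_)
  simp only [Matrix.updateRow_apply]
  split_ifs
  · exact contMDiffAt_const
  · exact hG k l

variable [IsManifold (𝓡 n) ∞ M]

theorem contMDiffAt_mvfderiv {f : M → ℝ} (hf : ContMDiffAt (𝓡 n) 𝓘(ℝ) ∞ f x)
    {X : ∀ y : M, TangentSpace (𝓡 n) y}
    (hX : ContMDiffAt (𝓡 n) ((𝓡 n).prod 𝓘(ℝ, EuclideanSpace ℝ (Fin n))) ∞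
      (fun y ↦ TotalSpace.mk' (EuclideanSpace ℝ (Fin n)) y (X y)) x) :
    ContMDiffAt (𝓡 n) 𝓘(ℝ) ∞ (fun y ↦ mvfderiv (𝓡 n) f y (X y)) x := by
  have h := ContMDiffAt.clm_apply_of_inCoordinates (F₂ := ℝ) (E₂ := TangentSpace 𝓘(ℝ)) (b₂ := f)
    (hf.mfderiv_const (m := ∞) (by simp)) hX hf
  rw [contMDiffAt_totalSpace] at h
  simp only [trivializationAt_model_space_apply] at h
  exact h.2

namespace SemiRiemannianMetric

variable (g : SemiRiemannianMetric n M)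

theorem contMDiffAt_inner {X Y : ∀ y : M, TangentSpace (𝓡 n) y}
    (hX : ContMDiffAt (𝓡 n) ((𝓡 n).prod 𝓘(ℝ, EuclideanSpace ℝ (Fin n))) ∞
      (fun y ↦ TotalSpace.mk' (EuclideanSpace ℝ (Fin n)) y (X y)) x)
    (hY : ContMDiffAt (𝓡 n) ((𝓡 n).prod 𝓘(ℝ, EuclideanSpace ℝ (Fin n))) ∞
      (fun y ↦ TotalSpace.mk' (EuclideanSpace ℝ (Fin n)) y (Y y)) x) :
    ContMDiffAt (𝓡 n) 𝓘(ℝ) ∞ (fun y ↦ g.inner y (X y) (Y y)) x := by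
  have h : ContMDiffAt (𝓡 n) ((𝓡 n).prod 𝓘(ℝ)) ∞
      (fun y ↦ TotalSpace.mk' ℝ (E := Bundle.Trivial M ℝ) y (g.inner y (X y) (Y y))) x :=
    ContMDiffAt.clm_bundle_apply₂ (F₁ := EuclideanSpace ℝ (Fin n))
      (F₂ := EuclideanSpace ℝ (Fin n)) g.contMDiff.contMDiffAt hX hY
  rw [contMDiffAt_totalSpace] at h
  exact h.2

theorem contMDiff_inner {X Y : ∀ y : M, TangentSpace (𝓡 n) y} (hX : SmoothField X)
    (hY : SmoothField Y) : ContMDiff (𝓡 n) 𝓘(ℝ) ∞ (fun y ↦ g.inner y (X y) (Y y)) :=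
  fun x ↦ g.contMDiffAt_inner (hX x) (hY x)

theorem mdifferentiableAt_inner {X Y : ∀ y : M, TangentSpace (𝓡 n) y}
    (hX : MDifferentiableAt (𝓡 n) ((𝓡 n).prod 𝓘(ℝ, EuclideanSpace ℝ (Fin n)))
      (fun y ↦ TotalSpace.mk' (EuclideanSpace ℝ (Fin n)) y (X y)) x)
    (hY : MDifferentiableAt (𝓡 n) ((𝓡 n).prod 𝓘(ℝ, EuclideanSpace ℝ (Fin n)))
      (fun y ↦ TotalSpace.mk' (EuclideanSpace ℝ (Fin n)) y (Y y)) x) :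
    MDifferentiableAt (𝓡 n) 𝓘(ℝ) (fun y ↦ g.inner y (X y) (Y y)) x := by
  have h : MDifferentiableAt (𝓡 n) ((𝓡 n).prod 𝓘(ℝ))
      (fun y ↦ TotalSpace.mk' ℝ (E := Bundle.Trivial M ℝ) y (g.inner y (X y) (Y y))) x :=
    MDifferentiableAt.clm_bundle_apply₂ (F₁ := EuclideanSpace ℝ (Fin n))
      (F₂ := EuclideanSpace ℝ (Fin n)) (g.contMDiff.mdifferentiableAt (by simp)) hX hY
  rw [mdifferentiableAt_totalSpace] at h
  exact h.2

variable [T2Space M]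

theorem exists_smoothField_basis (x : M) :
    ∃ X : Fin n → ∀ y : M, TangentSpace (𝓡 n) y, (∀ i, SmoothField (X i)) ∧
      ∀ᶠ y in 𝓝 x, (g.gramOf fun i ↦ X i y).det ≠ 0 := by
  choose X hX _ hXx using fun i ↦ exists_contMDiff_section_eventuallyEq_extend (n := n)
    (F := EuclideanSpace ℝ (Fin n)) x (frame (n := n) x i)
  have hdet : ContMDiffAt (𝓡 n) 𝓘(ℝ) ∞ (fun y ↦ (g.gramOf fun i ↦ X i y).det) x :=
    contMDiffAt_matrix_det fun i j ↦ g.contMDiffAt_inner (hX i x) (hX j x)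
  refine ⟨X, hX, hdet.continuousAt.eventually_ne ?_⟩
  simp only [hXx]
  exact g.det_gram_ne_zero x

theorem contMDiff_contract {F : Type*} [NormedAddCommGroup F] [NormedSpace ℝ F]
    {V : M → Type*} [TopologicalSpace (TotalSpace F V)]
    [∀ x, AddCommGroup (V x)] [∀ x, Module ℝ (V x)] [∀ x, TopologicalSpace (V x)]
    [FiberBundle F V] [VectorBundle ℝ F V]
    (B : ∀ y : M, TangentSpace (𝓡 n) y →ₗ[ℝ] TangentSpace (𝓡 n) y →ₗ[ℝ] V y)
    (hB : ∀ X Y : ∀ y : M, TangentSpace (𝓡 n) y, SmoothField X → SmoothField Y →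
      ContMDiff (𝓡 n) ((𝓡 n).prod 𝓘(ℝ, F)) ∞ (fun y ↦ TotalSpace.mk' F y (B y (X y) (Y y)))) :
    ContMDiff (𝓡 n) ((𝓡 n).prod 𝓘(ℝ, F)) ∞ (fun y ↦ TotalSpace.mk' F y (g.contract y (B y))) := by
  intro x
  obtain ⟨X, hX, hdet⟩ := g.exists_smoothField_basis x
  have hsmooth : ContMDiffAt (𝓡 n) ((𝓡 n).prod 𝓘(ℝ, F)) ∞ (fun y ↦ TotalSpace.mk' F y
      (∑ i, ∑ j, (g.gramOf fun i ↦ X i y)⁻¹ i j • B y (X i y) (X j y))) x :=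
    ContMDiffAt.sum_section fun i _ ↦ ContMDiffAt.sum_section fun j _ ↦
      (contMDiffAt_matrix_inv_apply (fun i j ↦ g.contMDiffAt_inner (hX i x) (hX j x))
        hdet.self_of_nhds i j).smul_section (hB _ _ (hX i) (hX j) x)
  refine hsmooth.congr_of_eventuallyEq ?_
  filter_upwards [hdet] with y hy
  obtain ⟨b, hb⟩ := g.exists_basis_of_det_gramOf_ne_zero _ hy
  rw [g.contract_eq_sum_gramOf b, hb]

/-- `Y` is the contraction of the smooth tensor `g(·, Y) ⊗ id`. -/
theorem smoothField_of_contMDiff_inner {Y : ∀ y : M, TangentSpace (𝓡 n) y}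
    (hY : ∀ Z : ∀ y : M, TangentSpace (𝓡 n) y, SmoothField Z →
      ContMDiff (𝓡 n) 𝓘(ℝ) ∞ (fun y ↦ g.inner y (Y y) (Z y))) : SmoothField Y := by
  let B (y : M) := LinearMap.mk₂ ℝ (fun u v : TangentSpace (𝓡 n) y ↦ g.inner y u (Y y) • v)
    (fun u v w ↦ by simp [add_smul]) (fun c u v ↦ by simp [mul_smul]) (fun u v w ↦ by simp)
    (fun c u v ↦ smul_comm _ _ _)
  have hB := g.contMDiff_contract (F := EuclideanSpace ℝ (Fin n)) B fun X Z hX hZ ↦ by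
    have hXY := hY X hX
    simp only [g.symm _ (Y _)] at hXY
    exact hXY.smul_section hZ
  have hcontract (y : M) : g.contract y (B y) = Y y :=
    g.contract_eq_apply_of_eq_inner_smul (B y) (Y y) LinearMap.id fun u v ↦ rfl
  simp only [hcontract] at hB
  exact hB

theorem smoothField_grad {f : M → ℝ} (hf : ContMDiff (𝓡 n) 𝓘(ℝ) ∞ f) :
    SmoothField (g.grad f) := by
  refine g.smoothField_of_contMDiff_inner fun Z hZ x ↦ ?_
  simp only [inner_grad]
  exact contMDiffAt_mvfderiv (hf x) (hZ x)

end SemiRiemannianMetric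

end MetricSmoothness

/-! ## The Levi-Civita connection -/

section LeviCivita

open VectorField

variable {n : ℕ} {M : Type*} [TopologicalSpace M] [ChartedSpace (EuclideanSpace ℝ (Fin n)) M]
  [IsManifold (𝓡 n) ∞ M]

theorem isManifold_minSmoothness (k : ℕ) : IsManifold (𝓡 n) (minSmoothness ℝ k) M := by
  rw [minSmoothness_of_isRCLikeNormedField]
  exact IsManifold.of_le (n := ∞) (mod_cast le_top)

/-- Differentiability of a vector field at a point: the regularity on which `koszul` and
`leviCivita` are tensorial, and which the local extensions in their definitions have. -/
abbrev FieldDiffAt (X : ∀ y : M, TangentSpace (𝓡 n) y) (x : M) : Prop :=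
  MDifferentiableAt (𝓡 n) ((𝓡 n).prod 𝓘(ℝ, EuclideanSpace ℝ (Fin n)))
    (fun y ↦ TotalSpace.mk' (EuclideanSpace ℝ (Fin n)) y (X y)) x

variable {X X' Y Y' Z Z' : ∀ y : M, TangentSpace (𝓡 n) y} {x : M}

theorem exists_mdifferentiableAt_field_apply_eq (x : M) (u : TangentSpace (𝓡 n) x) :
    ∃ X : ∀ y : M, TangentSpace (𝓡 n) y, FieldDiffAt X x ∧ X x = u :=
  ⟨_, FiberBundle.mdifferentiableAt_extend (𝓡 n) (EuclideanSpace ℝ (Fin n)) u,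
    FiberBundle.extend_apply_self _ _⟩

theorem SmoothField.mdifferentiableAt (hX : SmoothField X) (x : M) : FieldDiffAt X x :=
  ContMDiff.mdifferentiableAt hX (by simp)

theorem SmoothField.mlieBracket (hX : SmoothField X) (hY : SmoothField Y) :
    SmoothField (mlieBracket (𝓡 n) X Y) := by
  have : IsManifold (𝓡 n) (minSmoothness ℝ 2) M := isManifold_minSmoothness 2
  have : IsManifold (𝓡 n) (((⊤ : ℕ∞) : WithTop ℕ∞) + 1) M := inferInstanceAs (IsManifold _ ∞ M)
  exact fun y ↦ (hX y).mlieBracket_vectorField (n := ⊤) (m := ⊤) (hY y) (by simp)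

section Commutator

variable {f : M → ℝ}

theorem mlieBracket_smul_eq (hf : ContMDiff (𝓡 n) 𝓘(ℝ) ∞ f) (hY : SmoothField Y) :
    mlieBracket (𝓡 n) X (f • Y)
      = (fun y ↦ mvfderiv (𝓡 n) f y (X y)) • Y + f • mlieBracket (𝓡 n) X Y :=
  funext fun y ↦ mlieBracket_smul_right (hf.mdifferentiableAt (by simp)) (hY.mdifferentiableAt y)

theorem mlieBracket_mlieBracket_smul (hf : ContMDiff (𝓡 n) 𝓘(ℝ) ∞ f) (hY : SmoothField Y)
    (hZ : SmoothField Z) (x : M) :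
    mlieBracket (𝓡 n) X (mlieBracket (𝓡 n) Y (f • Z)) x
      = mvfderiv (𝓡 n) (fun y ↦ mvfderiv (𝓡 n) f y (Y y)) x (X x) • Z x
        + mvfderiv (𝓡 n) f x (Y x) • mlieBracket (𝓡 n) X Z x
        + (mvfderiv (𝓡 n) f x (X x) • mlieBracket (𝓡 n) Y Z x
        + f x • mlieBracket (𝓡 n) X (mlieBracket (𝓡 n) Y Z) x) := by
  have : IsManifold (𝓡 n) (minSmoothness ℝ 2) M := isManifold_minSmoothness 2
  have hYf : MDifferentiableAt (𝓡 n) 𝓘(ℝ) (fun y ↦ mvfderiv (𝓡 n) f y (Y y)) x :=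
    (contMDiffAt_mvfderiv (hf x) (hY x)).mdifferentiableAt (by simp)
  have hfx : MDifferentiableAt (𝓡 n) 𝓘(ℝ) f x := hf.mdifferentiableAt (by simp)
  have hYZ := (hY.mlieBracket hZ).mdifferentiableAt x
  have hZx := hZ.mdifferentiableAt x
  rw [mlieBracket_smul_eq hf hZ, mlieBracket_add_right (hYf.smul_section hZx)
    (hfx.smul_section hYZ), mlieBracket_smul_right hYf hZx, mlieBracket_smul_right hfx hYZ]

/-- Comparing the Jacobi identities for `X, Y, W` and `X, Y, f W` isolates the identity
multiplied by `W`; this avoids computing in charts. -/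
theorem mvfderiv_mlieBracket [T2Space M] (hf : ContMDiff (𝓡 n) 𝓘(ℝ) ∞ f)
    (hX : SmoothField X) (hY : SmoothField Y) (x : M) :
    mvfderiv (𝓡 n) f x (mlieBracket (𝓡 n) X Y x)
      = mvfderiv (𝓡 n) (fun y ↦ mvfderiv (𝓡 n) f y (Y y)) x (X x)
        - mvfderiv (𝓡 n) (fun y ↦ mvfderiv (𝓡 n) f y (X y)) x (Y x) := by
  have : IsManifold (𝓡 n) (minSmoothness ℝ 3) M := isManifold_minSmoothness 3
  obtain _ | _ := subsingleton_or_nontrivial (TangentSpace (𝓡 n) x)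
  · simp only [Subsingleton.elim _ (0 : TangentSpace (𝓡 n) x), map_zero, sub_zero]
  obtain ⟨w, hw⟩ := exists_ne (0 : TangentSpace (𝓡 n) x)
  obtain ⟨W, hW, -, rfl⟩ := exists_contMDiff_section_eventuallyEq_extend (n := n)
    (F := EuclideanSpace ℝ (Fin n)) x w
  have hle : minSmoothness ℝ 2 ≤ (∞ : WithTop ℕ∞) := by
    rw [minSmoothness_of_isRCLikeNormedField]
    exact WithTop.coe_le_coe.2 (le_top : (2 : ℕ∞) ≤ ⊤)
  have hjacobi {W : ∀ y : M, TangentSpace (𝓡 n) y} (hW : SmoothField W) :=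
    leibniz_identity_mlieBracket_apply (I := 𝓡 n) (x := x)
      ((hX x).of_le hle) ((hY x).of_le hle) ((hW x).of_le hle)
  have hfW := hjacobi (W := f • W) (hf.smul_section hW)
  rw [mlieBracket_mlieBracket_smul hf hY hW, mlieBracket_mlieBracket_smul hf hX hW,
    mlieBracket_smul_eq hf hW, hjacobi hW] at hfW
  simp only [Pi.add_apply, Pi.smul_apply'] at hfW
  refine smul_left_injective ℝ hw (sub_eq_zero.1 ?_)
  rw [← neg_eq_zero, ← sub_eq_zero.2 hfW]
  module

end Commutator

namespace SemiRiemannianMetric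

variable (g : SemiRiemannianMetric n M)

theorem inner_comm_fun (X Y : ∀ y : M, TangentSpace (𝓡 n) y) :
    (fun y ↦ g.inner y (X y) (Y y)) = fun y ↦ g.inner y (Y y) (X y) :=
  funext fun y ↦ g.symm y _ _

theorem mvfderiv_inner_add_left (hX : FieldDiffAt X x) (hX' : FieldDiffAt X' x)
    (hY : FieldDiffAt Y x) (u : TangentSpace (𝓡 n) x) :
    mvfderiv (𝓡 n) (fun y ↦ g.inner y ((X + X') y) (Y y)) x u
      = mvfderiv (𝓡 n) (fun y ↦ g.inner y (X y) (Y y)) x u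
        + mvfderiv (𝓡 n) (fun y ↦ g.inner y (X' y) (Y y)) x u := by
  simp only [Pi.add_apply, map_add, add_apply]
  exact congrArg (fun α ↦ α u)
    (mvfderiv_add (g.mdifferentiableAt_inner hX hY) (g.mdifferentiableAt_inner hX' hY))

theorem mvfderiv_inner_smul_left {f : M → ℝ} (hf : MDifferentiableAt (𝓡 n) 𝓘(ℝ) f x)
    (hX : FieldDiffAt X x) (hY : FieldDiffAt Y x) (u : TangentSpace (𝓡 n) x) :
    mvfderiv (𝓡 n) (fun y ↦ g.inner y ((f • X) y) (Y y)) x u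
      = f x * mvfderiv (𝓡 n) (fun y ↦ g.inner y (X y) (Y y)) x u
        + mvfderiv (𝓡 n) f x u * g.inner x (X x) (Y x) := by
  have hfg : (fun y ↦ g.inner y ((f • X) y) (Y y)) = f * fun y ↦ g.inner y (X y) (Y y) := by
    funext y
    simp
  rw [hfg, mvfderiv_mul hf (g.mdifferentiableAt_inner hX hY)]
  simp [mul_comm]

theorem tensorialAt_koszul_left (hY : FieldDiffAt Y x) (hZ : FieldDiffAt Z x) :
    TensorialAt (𝓡 n) (EuclideanSpace ℝ (Fin n)) (fun X ↦ g.koszul X Y Z x) x where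
  smul {f X} hf hX := by
    simp only [koszul]
    rw [g.mvfderiv_inner_smul_left hf hX hZ, g.mvfderiv_inner_smul_left hf hX hY,
      mlieBracket_smul_left hf hX, mlieBracket_smul_left hf hX]
    simp only [Pi.smul_apply', map_smul, smul_eq_mul, neg_smul, map_add, map_neg, add_apply,
      neg_apply, smul_apply]
    ring
  add {X X'} hX hX' := by
    simp only [koszul]
    rw [g.mvfderiv_inner_add_left hX hX' hZ, g.mvfderiv_inner_add_left hX hX' hY,
      mlieBracket_add_left hX hX', mlieBracket_add_left hX hX']
    simp only [Pi.add_apply, map_add, add_apply]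
    ring

theorem tensorialAt_koszul_right (hX : FieldDiffAt X x) (hY : FieldDiffAt Y x) :
    TensorialAt (𝓡 n) (EuclideanSpace ℝ (Fin n)) (fun Z ↦ g.koszul X Y Z x) x where
  smul {f Z} hf hZ := by
    simp only [koszul]
    rw [g.inner_comm_fun Y, g.inner_comm_fun X (f • Z), g.mvfderiv_inner_smul_left hf hZ hX,
      g.mvfderiv_inner_smul_left hf hZ hY,
      mlieBracket_smul_right hf hZ, mlieBracket_smul_right hf hZ,
      g.inner_comm_fun Y Z, g.inner_comm_fun X Z, g.symm x (Z x) (X x), g.symm x (Z x) (Y x)]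
    simp only [Pi.smul_apply', map_smul, smul_eq_mul, map_add, add_apply, smul_apply,
      g.symm x (Z x)]
    ring
  add {Z Z'} hZ hZ' := by
    simp only [koszul]
    rw [g.inner_comm_fun Y, g.inner_comm_fun X (Z + Z'), g.mvfderiv_inner_add_left hZ hZ' hX,
      g.mvfderiv_inner_add_left hZ hZ' hY,
      mlieBracket_add_right hZ hZ', mlieBracket_add_right hZ hZ',
      g.inner_comm_fun Y Z, g.inner_comm_fun X Z, g.inner_comm_fun Y Z', g.inner_comm_fun X Z']
    simp only [Pi.add_apply, map_add, add_apply]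
    ring

theorem koszul_add_middle (hX : FieldDiffAt X x) (hY : FieldDiffAt Y x)
    (hY' : FieldDiffAt Y' x) (hZ : FieldDiffAt Z x) :
    g.koszul X (Y + Y') Z x = g.koszul X Y Z x + g.koszul X Y' Z x := by
  simp only [koszul]
  rw [g.mvfderiv_inner_add_left hY hY' hZ, g.inner_comm_fun X (Y + Y'),
    g.mvfderiv_inner_add_left hY hY' hX, mlieBracket_add_right hY hY', mlieBracket_add_left hY hY',
    g.inner_comm_fun Y X, g.inner_comm_fun Y' X]
  simp only [Pi.add_apply, map_add, add_apply]
  ring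

theorem koszul_smul_middle {f : M → ℝ} (hf : MDifferentiableAt (𝓡 n) 𝓘(ℝ) f x)
    (hX : FieldDiffAt X x) (hY : FieldDiffAt Y x) (hZ : FieldDiffAt Z x) :
    g.koszul X (f • Y) Z x
      = f x * g.koszul X Y Z x + 2 * (mvfderiv (𝓡 n) f x (X x) * g.inner x (Y x) (Z x)) := by
  simp only [koszul]
  rw [g.mvfderiv_inner_smul_left hf hY hZ, g.inner_comm_fun X (f • Y),
    g.mvfderiv_inner_smul_left hf hY hX, mlieBracket_smul_right hf hY, mlieBracket_smul_left hf hY,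
    g.inner_comm_fun Y X]
  simp only [Pi.smul_apply', map_smul, smul_eq_mul, g.symm x (Y x) (X x), map_add, add_apply,
    smul_apply, neg_smul, map_neg, neg_apply]
  ring

theorem two_mul_inner_leviCivita (hX : FieldDiffAt X x) (hY : FieldDiffAt Y x)
    (hZ : FieldDiffAt Z x) :
    2 * g.inner x (g.leviCivita Y x (X x)) (Z x) = g.koszul X Y Z x := by
  have hext (u : TangentSpace (𝓡 n) x) :
      FieldDiffAt (FiberBundle.extend (EuclideanSpace ℝ (Fin n)) u) x :=
    FiberBundle.mdifferentiableAt_extend (𝓡 n) (EuclideanSpace ℝ (Fin n)) u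
  let U : ∀ y : M, TangentSpace (𝓡 n) y := FiberBundle.extend (EuclideanSpace ℝ (Fin n)) (X x)
  let L := TensorialAt.mkHom _ x (g.tensorialAt_koszul_right (X := U) (hext _) hY)
  have hL {Z : ∀ y : M, TangentSpace (𝓡 n) y} (hZ : FieldDiffAt Z x) :
      g.koszul U Y Z x = L (Z x) :=
    (TensorialAt.mkHom_apply (g.tensorialAt_koszul_right (X := U) (hext _) hY) hZ).symm
  have hcoord : g.leviCivita Y x (X x)
      = ∑ k, (L (g.reciprocal (frameBasis x) k) / 2) • frame x k := by
    have hframe (l : Fin n) :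
        g.koszul U Y (FiberBundle.extend (EuclideanSpace ℝ (Fin n)) (frame x l)) x
          = L (frame x l) := by
      rw [hL (hext _), FiberBundle.extend_apply_self]
    simp only [leviCivita]
    refine Finset.sum_congr rfl fun k _ ↦ ?_
    simp only [hframe, U, reciprocal, coe_frameBasis, gramOf_frame, map_sum, map_smul, smul_eq_mul,
      Finset.sum_div, mul_div_assoc]
  calc 2 * g.inner x (g.leviCivita Y x (X x)) (Z x)
      = L (∑ k, g.inner x (frame x k) (Z x) • g.reciprocal (frameBasis x) k) := by
        simp only [hcoord, map_sum, map_smul, sum_apply, smul_apply, smul_eq_mul, Finset.mul_sum]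
        exact Finset.sum_congr rfl fun k _ ↦ by ring
    _ = g.koszul U Y Z x := by
        rw [← coe_frameBasis, sum_inner_smul_reciprocal, hL hZ]
    _ = g.koszul X Y Z x := (g.tensorialAt_koszul_left hY hZ).pointwise (hext _) hX (by simp [U])

theorem ext_inner_of_mdifferentiableAt {u w : TangentSpace (𝓡 n) x}
    (h : ∀ Z : ∀ y : M, TangentSpace (𝓡 n) y, FieldDiffAt Z x →
      2 * g.inner x u (Z x) = 2 * g.inner x w (Z x)) : u = w := by
  refine g.ext_inner fun v ↦ ?_
  obtain ⟨Z, hZ, rfl⟩ := exists_mdifferentiableAt_field_apply_eq x v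
  exact mul_left_cancel₀ two_ne_zero (h Z hZ)

theorem leviCivita_add_left (hY : FieldDiffAt Y x) (u v : TangentSpace (𝓡 n) x) :
    g.leviCivita Y x (u + v) = g.leviCivita Y x u + g.leviCivita Y x v := by
  obtain ⟨X, hX, rfl⟩ := exists_mdifferentiableAt_field_apply_eq x u
  obtain ⟨X', hX', rfl⟩ := exists_mdifferentiableAt_field_apply_eq x v
  refine g.ext_inner_of_mdifferentiableAt fun Z hZ ↦ ?_
  have h := g.two_mul_inner_leviCivita (mdifferentiableAt_add_section hX hX') hY hZ
  rw [(g.tensorialAt_koszul_left hY hZ).add hX hX', ← g.two_mul_inner_leviCivita hX hY hZ,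
    ← g.two_mul_inner_leviCivita hX' hY hZ] at h
  rw [map_add, add_apply, mul_add]
  exact h

theorem leviCivita_smul_left (hY : FieldDiffAt Y x) (c : ℝ) (u : TangentSpace (𝓡 n) x) :
    g.leviCivita Y x (c • u) = c • g.leviCivita Y x u := by
  obtain ⟨X, hX, rfl⟩ := exists_mdifferentiableAt_field_apply_eq x u
  refine g.ext_inner_of_mdifferentiableAt fun Z hZ ↦ ?_
  have hc : MDifferentiableAt (𝓡 n) 𝓘(ℝ) (fun _ : M ↦ c) x := mdifferentiableAt_const
  have h := g.two_mul_inner_leviCivita (hc.smul_section hX) hY hZ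
  rw [(g.tensorialAt_koszul_left hY hZ).smul hc hX, ← g.two_mul_inner_leviCivita hX hY hZ] at h
  rw [map_smul, smul_apply, smul_eq_mul, mul_left_comm]
  exact h

theorem leviCivita_add (hY : FieldDiffAt Y x) (hY' : FieldDiffAt Y' x)
    (u : TangentSpace (𝓡 n) x) :
    g.leviCivita (Y + Y') x u = g.leviCivita Y x u + g.leviCivita Y' x u := by
  obtain ⟨X, hX, rfl⟩ := exists_mdifferentiableAt_field_apply_eq x u
  refine g.ext_inner_of_mdifferentiableAt fun Z hZ ↦ ?_
  rw [g.two_mul_inner_leviCivita hX (mdifferentiableAt_add_section hY hY') hZ,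
    g.koszul_add_middle hX hY hY' hZ, ← g.two_mul_inner_leviCivita hX hY hZ,
    ← g.two_mul_inner_leviCivita hX hY' hZ, map_add, add_apply, mul_add]

theorem leviCivita_smul {f : M → ℝ} (hf : MDifferentiableAt (𝓡 n) 𝓘(ℝ) f x)
    (hY : FieldDiffAt Y x) (u : TangentSpace (𝓡 n) x) :
    g.leviCivita (f • Y) x u = f x • g.leviCivita Y x u + mvfderiv (𝓡 n) f x u • Y x := by
  obtain ⟨X, hX, rfl⟩ := exists_mdifferentiableAt_field_apply_eq x u
  refine g.ext_inner_of_mdifferentiableAt fun Z hZ ↦ ?_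
  rw [g.two_mul_inner_leviCivita hX (hf.smul_section hY) hZ,
    g.koszul_smul_middle hf hX hY hZ, ← g.two_mul_inner_leviCivita hX hY hZ]
  simp only [map_add, map_smul, add_apply, smul_apply, smul_eq_mul]
  ring

theorem mvfderiv_inner (hY : FieldDiffAt Y x) (hZ : FieldDiffAt Z x)
    (u : TangentSpace (𝓡 n) x) :
    mvfderiv (𝓡 n) (fun y ↦ g.inner y (Y y) (Z y)) x u
      = g.inner x (g.leviCivita Y x u) (Z x) + g.inner x (Y x) (g.leviCivita Z x u) := by
  obtain ⟨X, hX, rfl⟩ := exists_mdifferentiableAt_field_apply_eq x u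
  have hYZ := g.two_mul_inner_leviCivita hX hY hZ
  have hZY := g.two_mul_inner_leviCivita hX hZ hY
  rw [g.symm x (Y x)]
  simp only [koszul] at hYZ hZY
  rw [g.inner_comm_fun Z Y, mlieBracket_swap_apply (V := Z) (W := Y)] at hZY
  simp only [map_neg, neg_apply] at hZY
  linarith

theorem leviCivita_sub_leviCivita (hX : FieldDiffAt X x) (hY : FieldDiffAt Y x) :
    g.leviCivita Y x (X x) - g.leviCivita X x (Y x) = mlieBracket (𝓡 n) X Y x := by
  refine g.ext_inner_of_mdifferentiableAt fun Z hZ ↦ ?_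
  have hXY := g.two_mul_inner_leviCivita hX hY hZ
  have hYX := g.two_mul_inner_leviCivita hY hX hZ
  simp only [koszul] at hXY hYX
  rw [g.inner_comm_fun Y X, mlieBracket_swap_apply (V := Y) (W := X)] at hYX
  simp only [map_sub, map_neg, neg_apply, sub_apply] at hYX ⊢
  linarith

theorem contMDiff_koszul (hX : SmoothField X) (hY : SmoothField Y) (hZ : SmoothField Z) :
    ContMDiff (𝓡 n) 𝓘(ℝ) ∞ fun y ↦ g.koszul X Y Z y := by
  have hderiv {X Y Z : ∀ y : M, TangentSpace (𝓡 n) y} (hX : SmoothField X) (hY : SmoothField Y)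
      (hZ : SmoothField Z) : ContMDiff (𝓡 n) 𝓘(ℝ) ∞
        fun y ↦ mvfderiv (𝓡 n) (fun y ↦ g.inner y (Y y) (Z y)) y (X y) :=
    fun y ↦ contMDiffAt_mvfderiv (g.contMDiff_inner hY hZ y) (hX y)
  exact (((((hderiv hX hY hZ).add (hderiv hY hX hZ)).sub (hderiv hZ hX hY)).add
    (g.contMDiff_inner (hX.mlieBracket hY) hZ)).sub
    (g.contMDiff_inner (hX.mlieBracket hZ) hY)).sub
    (g.contMDiff_inner (hY.mlieBracket hZ) hX)

theorem smoothField_leviCivita [T2Space M] (hX : SmoothField X) (hY : SmoothField Y) :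
    SmoothField fun y ↦ g.leviCivita Y y (X y) := by
  refine g.smoothField_of_contMDiff_inner fun Z hZ ↦ ?_
  have hkoszul (y : M) : g.inner y (g.leviCivita Y y (X y)) (Z y) = 2⁻¹ * g.koszul X Y Z y := by
    rw [← g.two_mul_inner_leviCivita (hX.mdifferentiableAt y) (hY.mdifferentiableAt y)
      (hZ.mdifferentiableAt y), inv_mul_cancel_left₀ two_ne_zero]
  simp only [hkoszul]
  exact contMDiff_const.mul (g.contMDiff_koszul hX hY hZ)

end SemiRiemannianMetric

end LeviCivita

/-! ## The chirality operator -/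

section Chirality

theorem alternatingMap_apply_eq_det_smul {R E W ι : Type*} [CommRing R] [AddCommGroup E]
    [Module R E] [AddCommGroup W] [Module R W] [Fintype ι] [DecidableEq ι] (f : E [⋀^ι]→ₗ[R] W)
    (b : Module.Basis ι R E) (v : ι → E) : f v = b.det v • f b := by
  have hf : f = (LinearMap.toSpanSingleton R W (f b)).compAlternatingMap b.det := by
    refine b.ext_alternating fun i hi ↦ ?_
    let σ : Equiv.Perm ι := Equiv.ofBijective i (Finite.injective_iff_bijective.1 hi)
    change f (b ∘ σ) = b.det (b ∘ σ) • f b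
    simp [AlternatingMap.map_perm, Module.Basis.det_self]
  conv_lhs => rw [hf]
  rfl

theorem neg_one_pow_choose_two {R : Type*} [Monoid R] [HasDistribNeg R] {n : ℕ} (hn : Even n) :
    (-1 : R) ^ n.choose 2 = (-1) ^ (n / 2) := by
  obtain ⟨_ | k, rfl⟩ := hn
  · simp
  have hodd : Odd (2 * k + 1) := odd_two_mul_add_one k
  have hchoose : (k + 1 + (k + 1)).choose 2 = (2 * k + 1) * (k + 1) := by
    rw [Nat.choose_two_right, ← two_mul, mul_assoc, Nat.mul_div_cancel_left _ two_pos, mul_comm]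
    rfl
  rw [hchoose, pow_mul, hodd.neg_one_pow, ← two_mul, Nat.mul_div_cancel_left _ two_pos]

variable {n : ℕ} {M : Type*} [TopologicalSpace M] [ChartedSpace (EuclideanSpace ℝ (Fin n)) M]
  [IsManifold (𝓡 n) ∞ M]

namespace SemiRiemannianMetric

variable (g : SemiRiemannianMetric n M) {x : M}
  (b : Module.Basis (Fin n) ℝ (TangentSpace (𝓡 n) x))

theorem det_gram_eq_mul : (g.gram x).det = b.det (frame x) ^ 2 * (g.gramOf b).det := by
  rw [← gramOf_frame, ← coe_frameBasis, gramOf_eq_toMatrix, gramOf_eq_toMatrix,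
    ← LinearMap.BilinForm.toMatrix_mul_basis_toMatrix b, Matrix.det_mul, Matrix.det_mul,
    Matrix.det_transpose, Module.Basis.det_apply]
  ring

omit [IsManifold (𝓡 n) ∞ M] in
theorem det_frame_ne_zero : b.det (frame x) ≠ 0 := by
  rw [← coe_frameBasis]
  exact (b.isUnit_det (frameBasis x)).ne_zero

theorem sign_det_gram_eq : SignType.sign (g.gram x).det = SignType.sign (g.gramOf b).det := by
  have hpos : 0 < b.det (frame x) ^ 2 := by
    have := det_frame_ne_zero b
    positivity
  rw [g.det_gram_eq_mul b, sign_mul, sign_pos hpos, one_mul]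

theorem alternatingMap_reciprocal {W : Type*} [AddCommGroup W] [Module ℝ W]
    (f : (TangentSpace (𝓡 n) x) [⋀^Fin n]→ₗ[ℝ] W) :
    f (g.reciprocal b) = (g.gramOf b).det⁻¹ • f b := by
  have hrepr : b.toMatrix (g.reciprocal b) = (g.gramOf b)⁻¹.transpose := by
    ext k i
    simp [reciprocal, Module.Basis.toMatrix_apply, Finsupp.single_apply]
  rw [alternatingMap_apply_eq_det_smul f b, Module.Basis.det_apply, hrepr, Matrix.det_transpose,
    Matrix.det_nonsing_inv, Ring.inverse_eq_inv']

end SemiRiemannianMetric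

variable {F : Type*} [NormedAddCommGroup F] [NormedSpace ℂ F]
  {V : M → Type*} [TopologicalSpace (TotalSpace F V)]
  [∀ x, AddCommGroup (V x)] [∀ x, Module ℂ (V x)] [∀ x, TopologicalSpace (V x)]
  [FiberBundle F V]

namespace CliffordAction

variable {g : SemiRiemannianMetric n M} (γ : CliffordAction F V g) (μ : g.VolumeForm) {x : M}

/-- The Clifford action `γ(u^♭)` of tangent vectors. -/
def cl (x : M) : TangentSpace (𝓡 n) x →ₗ[ℝ] Module.End ℂ (V x) :=
  γ.act x ∘ₗ (g.inner x).toLinearMap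

theorem cl_apply (u : TangentSpace (𝓡 n) x) : γ.cl x u = γ.act x (g.inner x u) := rfl

theorem act_eq_cl_sharp (α : TangentSpace (𝓡 n) x →L[ℝ] ℝ) : γ.act x α = γ.cl x (g.sharp α) := by
  rw [cl_apply, g.inner_sharp]

theorem act_coframe (x : M) (i : Fin n) :
    γ.act x (coframe x i) = γ.cl x (g.reciprocal (frameBasis x) i) := by
  rw [cl_apply, g.coframe_eq_inner_reciprocal]

/-- The sign `ε` of the Clifford relation as a real number. -/
def sgn : ℝ := ((γ.sign : ℤ) : ℝ)

theorem sgn_mul_self : γ.sgn * γ.sgn = 1 := by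
  rcases Int.units_eq_one_or γ.sign with h | h <;> simp [sgn, h]

theorem sgn_ne_zero : γ.sgn ≠ 0 := left_ne_zero_of_mul_eq_one γ.sgn_mul_self

theorem cl_mul_add (u v : TangentSpace (𝓡 n) x) :
    γ.cl x u * γ.cl x v + γ.cl x v * γ.cl x u = (2 * γ.sgn * g.inner x u v) • 1 := by
  have h := γ.clifford x u v
  rw [Complex.coe_smul] at h
  exact h

theorem cl_mul_self (u : TangentSpace (𝓡 n) x) :
    γ.cl x u * γ.cl x u = (γ.sgn * g.inner x u u) • 1 := by
  have h := γ.cl_mul_add u u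
  rw [← two_smul ℝ, mul_assoc, mul_smul] at h
  exact smul_right_injective _ two_ne_zero h

variable {e : Module.Basis (Fin n) ℝ (TangentSpace (𝓡 n) x)} {d : Fin n → ℝ}

theorem isCliffordFamily_cl (he : g.IsOrthogonal e d) :
    IsCliffordFamily (fun i ↦ γ.cl x (e i)) fun i ↦ γ.sgn * d i where
  sq i := by rw [cl_mul_self, he.inner_eq, if_pos rfl]
  anticomm i j hij := by
    have h := γ.cl_mul_add (e i) (e j)
    rw [he.inner_eq, if_neg hij, mul_zero, zero_smul] at h
    exact eq_neg_of_add_eq_zero_left h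

/-- The antisymmetrized Clifford product of `n` tangent vectors. -/
def clAlt (x : M) : (TangentSpace (𝓡 n) x) [⋀^Fin n]→ₗ[ℝ] Module.End ℂ (V x) :=
  MultilinearMap.alternatization
    ((MultilinearMap.mkPiAlgebraFin ℝ n (Module.End ℂ (V x))).compLinearMap fun _ ↦ γ.cl x)

theorem clAlt_apply (v : Fin n → TangentSpace (𝓡 n) x) :
    γ.clAlt x v = ∑ σ : Equiv.Perm (Fin n),
      Equiv.Perm.sign σ • (List.ofFn fun i ↦ γ.cl x (v (σ i))).prod :=
  MultilinearMap.alternatization_apply _ _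

theorem clAlt_of_isOrthogonal (he : g.IsOrthogonal e d) :
    γ.clAlt x e = (n.factorial : ℝ) • (List.ofFn fun i ↦ γ.cl x (e i)).prod := by
  have hperm (σ : Equiv.Perm (Fin n)) :=
    prod_ofFn_perm_of_anticomm _ (γ.isCliffordFamily_cl he).anticomm σ
  simp only [clAlt_apply, hperm, smul_smul, Int.units_mul_self, one_smul, Finset.sum_const,
    Finset.card_univ, Fintype.card_perm, Fintype.card_fin, Nat.cast_smul_eq_nsmul]

theorem volume_eq_frame_smul_clAlt (x : M) :
    γ.volume μ x = ((n.factorial : ℝ)⁻¹ * μ.toFun x (frame x)) •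
      γ.clAlt x (g.reciprocal (frameBasis x)) := by
  have hterm (σ : Equiv.Perm (Fin n)) : ((μ.toFun x (fun i ↦ frame x (σ i)) : ℝ) : ℂ) •
      (List.ofFn fun i ↦ γ.act x (coframe x (σ i))).prod
        = μ.toFun x (frame x) • Equiv.Perm.sign σ •
          (List.ofFn fun i ↦ γ.cl x (g.reciprocal (frameBasis x) (σ i))).prod := by
    have hσ : μ.toFun x (fun i ↦ frame x (σ i)) = Equiv.Perm.sign σ • μ.toFun x (frame x) :=
      (μ.toFun x).map_perm (frame x) σ
    rw [Complex.coe_smul, hσ, smul_assoc, smul_comm]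
    simp only [act_coframe]
  rw [volume, Finset.sum_congr rfl fun σ _ ↦ hterm σ, ← Finset.smul_sum, ← clAlt_apply, mul_smul,
    ← Complex.ofReal_natCast, ← Complex.ofReal_inv, Complex.coe_smul]

theorem volume_eq_smul_clAlt (b : Module.Basis (Fin n) ℝ (TangentSpace (𝓡 n) x)) :
    γ.volume μ x = ((n.factorial : ℝ)⁻¹ * (μ.toFun x b * (g.gramOf b).det⁻¹)) • γ.clAlt x b := by
  rw [volume_eq_frame_smul_clAlt, g.alternatingMap_reciprocal, coe_frameBasis,
    SemiRiemannianMetric.gramOf_frame, g.det_gram_eq_mul b,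
    alternatingMap_apply_eq_det_smul (γ.clAlt x) b (frame x),
    alternatingMap_apply_eq_det_smul (μ.toFun x) b (frame x), smul_smul, smul_smul, smul_eq_mul]
  congr 1
  have := SemiRiemannianMetric.det_frame_ne_zero b
  have := g.det_gramOf_ne_zero b
  field_simp

theorem volume_of_isOrthogonal (he : g.IsOrthogonal e d) :
    γ.volume μ x
      = (μ.toFun x e * (∏ i, d i)⁻¹) • (List.ofFn fun i ↦ γ.cl x (e i)).prod := by
  rw [γ.volume_eq_smul_clAlt μ e, he.gramOf_eq, Matrix.det_diagonal, γ.clAlt_of_isOrthogonal he,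
    smul_smul]
  congr 1
  have : (n.factorial : ℝ) ≠ 0 := by positivity
  field_simp

theorem volume_mul_cl (hn : Even n) (u : TangentSpace (𝓡 n) x) :
    γ.volume μ x * γ.cl x u = -(γ.cl x u * γ.volume μ x) := by
  obtain ⟨e, d, he⟩ := g.exists_isOrthogonal x
  have hbasis (k : Fin n) :
      γ.volume μ x * γ.cl x (e k) = -(γ.cl x (e k) * γ.volume μ x) := by
    rw [γ.volume_of_isOrthogonal μ he, mul_smul_comm, smul_mul_assoc,
      mul_prod_ofFn_of_anticomm _ (γ.isCliffordFamily_cl he).anticomm k, hn.neg_one_pow, one_smul,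
      smul_neg, neg_neg]
  rw [← e.sum_repr u]
  simp only [map_sum, map_smul, Finset.mul_sum, Finset.sum_mul, mul_smul_comm, smul_mul_assoc,
    hbasis, smul_neg, Finset.sum_neg_distrib]

theorem volume_mul_self (hn : Even n) (x : M) :
    γ.volume μ x * γ.volume μ x
      = ((-1 : ℝ) ^ (n / 2) * (SignType.sign (g.gram x).det : ℝ)) • 1 := by
  obtain ⟨e, d, he⟩ := g.exists_isOrthogonal x
  have hdet : (g.gramOf e).det = ∏ i, d i := by rw [he.gramOf_eq, Matrix.det_diagonal]
  have hsq : μ.toFun x e * μ.toFun x e = |∏ i, d i| := by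
    rw [← hdet, ← sq]
    exact μ.sq_eq x e
  have hprod : (List.ofFn fun i ↦ γ.cl x (e i)).prod * (List.ofFn fun i ↦ γ.cl x (e i)).prod
      = ((-1 : ℝ) ^ (n / 2) * ∏ i, d i) • 1 := by
    have hsgn : γ.sgn ^ n = 1 := by
      obtain ⟨k, hk⟩ := hn
      calc γ.sgn ^ n = γ.sgn ^ (k + k) := congrArg (γ.sgn ^ ·) hk
        _ = 1 := by rw [pow_add, ← mul_pow, sgn_mul_self, one_pow]
    rw [(γ.isCliffordFamily_cl he).prod_ofFn_mul_self, neg_one_pow_choose_two hn,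
      Finset.prod_mul_distrib, Finset.prod_const, Finset.card_univ, Fintype.card_fin, hsgn, one_mul]
    rcases Nat.even_or_odd (n / 2) with h | h <;> simp [h.neg_one_pow]
  rw [γ.volume_of_isOrthogonal μ he, smul_mul_smul_comm, hprod, smul_smul, g.sign_det_gram_eq e,
    hdet]
  congr 1
  have hne : ∏ i, d i ≠ 0 := Finset.prod_ne_zero_iff.2 fun i _ ↦ he.ne_zero i
  calc _ = (-1) ^ (n / 2) * (μ.toFun x e * μ.toFun x e / ∏ i, d i) := by field_simp
    _ = (-1) ^ (n / 2) * (SignType.sign (∏ i, d i) : ℝ) := by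
      rw [hsq]
      rcases hne.lt_or_gt with h | h
      · rw [abs_of_neg h, sign_neg h, neg_div, div_self hne, SignType.coe_neg_one]
      · rw [abs_of_pos h, sign_pos h, div_self hne, SignType.coe_one]

theorem chirality_mul_cl (hn : Even n) (u : TangentSpace (𝓡 n) x) :
    γ.chirality μ x * γ.cl x u = -(γ.cl x u * γ.chirality μ x) := by
  rw [chirality, smul_mul_assoc, γ.volume_mul_cl μ hn, smul_neg, mul_smul_comm]

theorem chirality_mul_self (hn : Even n) (x : M) : γ.chirality μ x * γ.chirality μ x = 1 := by
  have hI (m : ℕ) : (Complex.I ^ m) * (Complex.I ^ m) = (-1) ^ m := by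
    rw [← mul_pow, Complex.I_mul_I]
  have hsq (m : ℕ) : ((-1 : ℂ)) ^ m * (-1) ^ m = 1 := by rw [← mul_pow]; simp
  rw [chirality, smul_mul_smul_comm, γ.volume_mul_self μ hn, ← Complex.coe_smul, smul_smul]
  rcases (g.det_gram_ne_zero x).lt_or_gt with h | h
  · simp [h.not_gt, sign_neg h, hI, pow_succ (-1 : ℂ), hsq]
  · simp [h, sign_pos h, hI, hsq]

end CliffordAction

end Chirality

section SmoothEndomorphisms

open Filter
open scoped Topology

variable {n : ℕ} {M : Type*} [TopologicalSpace M] [ChartedSpace (EuclideanSpace ℝ (Fin n)) M]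

theorem SemiRiemannianMetric.sign_det_gram_eventuallyEq
    [IsManifold (𝓡 n) ∞ M] [T2Space M] (g : SemiRiemannianMetric n M) (x : M) :
    ∀ᶠ y in 𝓝 x, SignType.sign (g.gram y).det = SignType.sign (g.gram x).det := by
  obtain ⟨X, hX, hdet⟩ := g.exists_smoothField_basis x
  have hsign : ∀ᶠ y in 𝓝 x,
      SignType.sign (g.gram y).det = SignType.sign (g.gramOf fun i ↦ X i y).det := by
    filter_upwards [hdet] with y hy
    obtain ⟨b, hb⟩ := g.exists_basis_of_det_gramOf_ne_zero _ hy
    rw [g.sign_det_gram_eq b, hb]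
  have hdetSmooth : ContMDiffAt (𝓡 n) 𝓘(ℝ) ∞ (fun y ↦ (g.gramOf fun i ↦ X i y).det) x :=
    contMDiffAt_matrix_det fun i j ↦ g.contMDiffAt_inner (hX i x) (hX j x)
  have hcont : ContinuousAt (fun y ↦ SignType.sign (g.gramOf fun i ↦ X i y).det) x :=
    ContinuousAt.comp (g := SignType.sign) (continuousAt_sign_of_ne_zero hdet.self_of_nhds)
      hdetSmooth.continuousAt
  filter_upwards [hsign, hcont.eventually (IsOpen.mem_nhds (isOpen_discrete {_}) rfl)] with y hy hyx
  rw [hy, hsign.self_of_nhds, hyx]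

variable {F : Type*} [NormedAddCommGroup F] [NormedSpace ℂ F]
  {V : M → Type*} [TopologicalSpace (TotalSpace F V)]
  [∀ x, AddCommGroup (V x)] [∀ x, Module ℂ (V x)] [∀ x, TopologicalSpace (V x)]
  [FiberBundle F V] {s t : ∀ x : M, V x}

theorem contMDiffAt_const_smul_section [VectorBundle ℂ F V] (c : ℂ) {x : M}
    (hs : ContMDiffAt (𝓡 n) ((𝓡 n).prod 𝓘(ℝ, F)) ∞ (fun y ↦ TotalSpace.mk' F y (s y)) x) :
    ContMDiffAt (𝓡 n) ((𝓡 n).prod 𝓘(ℝ, F)) ∞ (fun y ↦ TotalSpace.mk' F y (c • s y)) x := by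
  rw [contMDiffAt_section] at hs ⊢
  have hsmul := ContMDiffAt.comp x (I' := 𝓘(ℝ, F)) (g := fun v : F ↦ c • v)
    (contDiff_const_smul (𝕜 := ℝ) c).contMDiff.contMDiffAt hs
  refine hsmul.congr_of_eventuallyEq ?_
  filter_upwards [(trivializationAt F V x).open_baseSet.mem_nhds
    (FiberBundle.mem_baseSet_trivializationAt' x)] with y hy
  exact ((trivializationAt F V x).linear ℂ hy).map_smul c (s y)

namespace SmoothSection

omit [∀ x, AddCommGroup (V x)] [∀ x, Module ℂ (V x)] in
theorem mdifferentiableAt (hs : SmoothSection (n := n) F s) (x : M) :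
    MDifferentiableAt (𝓡 n) ((𝓡 n).prod 𝓘(ℝ, F)) (fun y ↦ TotalSpace.mk' F y (s y)) x :=
  ContMDiff.mdifferentiableAt hs (by simp)

theorem const_smul [VectorBundle ℂ F V] (c : ℂ) (hs : SmoothSection (n := n) F s) :
    SmoothSection (n := n) F fun x ↦ c • s x :=
  fun x ↦ contMDiffAt_const_smul_section c (hs x)

variable [VectorBundle ℝ F V]

theorem add (hs : SmoothSection (n := n) F s) (ht : SmoothSection (n := n) F t) :
    SmoothSection (n := n) F fun x ↦ s x + t x :=
  ContMDiff.add_section hs ht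

theorem sub (hs : SmoothSection (n := n) F s) (ht : SmoothSection (n := n) F t) :
    SmoothSection (n := n) F fun x ↦ s x - t x :=
  ContMDiff.sub_section hs ht

theorem smul {f : M → ℝ} (hf : ContMDiff (𝓡 n) 𝓘(ℝ) ∞ f) (hs : SmoothSection (n := n) F s) :
    SmoothSection (n := n) F fun x ↦ f x • s x :=
  ContMDiff.smul_section hf hs

end SmoothSection

variable [IsManifold (𝓡 n) ∞ M]

namespace CliffordAction

variable {g : SemiRiemannianMetric n M} (γ : CliffordAction F V g) (μ : g.VolumeForm)

theorem smoothSection_cl {X : ∀ x : M, TangentSpace (𝓡 n) x} (hX : SmoothField X)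
    (hs : SmoothSection (n := n) F s) : SmoothSection (n := n) F fun x ↦ γ.cl x (X x) (s x) :=
  γ.smooth X s hX hs

theorem smoothSection_prod_cl (hs : SmoothSection (n := n) F s) {m : ℕ}
    (X : Fin m → ∀ x : M, TangentSpace (𝓡 n) x) (hX : ∀ i, SmoothField (X i)) :
    SmoothSection (n := n) F fun x ↦ (List.ofFn fun i ↦ γ.cl x (X i x)).prod (s x) := by
  induction m with
  | zero => simpa using hs
  | succ m ih =>
    have hprod := γ.smoothSection_cl (hX 0) (ih (fun i ↦ X i.succ) fun i ↦ hX i.succ)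
    simpa only [List.ofFn_succ, List.prod_cons, Module.End.mul_apply] using hprod

theorem smoothSection_clAlt [VectorBundle ℝ F V] (hs : SmoothSection (n := n) F s)
    {X : Fin n → ∀ x : M, TangentSpace (𝓡 n) x} (hX : ∀ i, SmoothField (X i)) :
    SmoothSection (n := n) F fun x ↦ γ.clAlt x (fun i ↦ X i x) (s x) := by
  have hsum : SmoothSection (n := n) F fun x ↦ ∑ σ : Equiv.Perm (Fin n),
      ((Equiv.Perm.sign σ : ℤ) : ℝ) • (List.ofFn fun i ↦ γ.cl x (X (σ i) x)).prod (s x) :=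
    ContMDiff.sum_section fun σ _ ↦ ContMDiff.smul_section contMDiff_const
      (γ.smoothSection_prod_cl hs (fun i ↦ X (σ i)) fun i ↦ hX (σ i))
  simp only [Int.cast_smul_eq_zsmul] at hsum
  simp only [clAlt_apply, LinearMap.sum_apply, LinearMap.smul_apply, Units.smul_def]
  exact hsum

variable [T2Space M]

theorem smoothEnd_volume [VectorBundle ℝ F V] : SmoothEnd (n := n) F (γ.volume μ) := by
  intro s hs x
  obtain ⟨X, hX, hdet⟩ := g.exists_smoothField_basis x
  have hvol : ∀ᶠ y in 𝓝 x, γ.volume μ y (s y) =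
      ((n.factorial : ℝ)⁻¹ * (μ.toFun y (fun i ↦ X i y) * (g.gramOf fun i ↦ X i y).det⁻¹)) •
        γ.clAlt y (fun i ↦ X i y) (s y) := by
    filter_upwards [hdet] with y hy
    obtain ⟨b, hb⟩ := g.exists_basis_of_det_gramOf_ne_zero _ hy
    rw [γ.volume_eq_smul_clAlt μ b, hb, LinearMap.smul_apply]
  have hdetSmooth : ContMDiffAt (𝓡 n) 𝓘(ℝ) ∞ (fun y ↦ (g.gramOf fun i ↦ X i y).det) x :=
    contMDiffAt_matrix_det fun i j ↦ g.contMDiffAt_inner (hX i x) (hX j x)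
  have hcoeff := contMDiffAt_const (c := (n.factorial : ℝ)⁻¹).mul
    ((μ.smooth X hX x).mul (hdetSmooth.inv₀ hdet.self_of_nhds))
  exact (hcoeff.smul_section (γ.smoothSection_clAlt hs hX x)).congr_of_eventuallyEq
    (hvol.mono fun y hy ↦ congrArg (TotalSpace.mk' F y) hy)

theorem smoothEnd_chirality [VectorBundle ℂ F V] [VectorBundle ℝ F V] :
    SmoothEnd (n := n) F (γ.chirality μ) := by
  intro s hs x
  have hvol := contMDiffAt_const_smul_section
    (if 0 < (g.gram x).det then Complex.I ^ (n / 2) else Complex.I ^ (n / 2 + 1))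
    (γ.smoothEnd_volume μ s hs x)
  refine hvol.congr_of_eventuallyEq ?_
  filter_upwards [g.sign_det_gram_eventuallyEq x] with y hy
  have hpos : 0 < (g.gram y).det ↔ 0 < (g.gram x).det := by
    rw [← sign_eq_one_iff, hy, sign_eq_one_iff]
  simp only [chirality, hpos, LinearMap.smul_apply]

end CliffordAction

end SmoothEndomorphisms

/-! ## Connections -/

section Connections

open Filter
open scoped Topology

variable {n : ℕ} {M : Type*} [TopologicalSpace M] [ChartedSpace (EuclideanSpace ℝ (Fin n)) M]
  {x : M}

section VectorFields

variable [IsManifold (𝓡 n) ∞ M]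

namespace SmoothField

variable {X Y : ∀ x : M, TangentSpace (𝓡 n) x}

theorem add (hX : SmoothField X) (hY : SmoothField Y) : SmoothField (X + Y) :=
  ContMDiff.add_section hX hY

theorem smul {f : M → ℝ} (hf : ContMDiff (𝓡 n) 𝓘(ℝ) ∞ f) (hX : SmoothField X) :
    SmoothField (f • X) :=
  ContMDiff.smul_section hf hX

end SmoothField

theorem SemiRiemannianMetric.leviCivita_congr (g : SemiRiemannianMetric n M)
    {Y Y' : ∀ y : M, TangentSpace (𝓡 n) y} (hY : FieldDiffAt Y x) (hY' : FieldDiffAt Y' x)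
    (h : ∀ᶠ y in 𝓝 x, Y y = Y' y) (u : TangentSpace (𝓡 n) x) :
    g.leviCivita Y x u = g.leviCivita Y' x u := by
  refine g.ext_inner_of_mdifferentiableAt fun Z hZ ↦ ?_
  have heq : (fun y ↦ g.inner y (Y y) (Z y)) =ᶠ[𝓝 x] fun y ↦ g.inner y (Y' y) (Z y) :=
    h.mono fun y hy ↦ congrArg (g.inner y · (Z y)) hy
  have hderiv : mvfderiv (𝓡 n) (fun y ↦ g.inner y (Y y) (Z y)) x u
      = mvfderiv (𝓡 n) (fun y ↦ g.inner y (Y' y) (Z y)) x u :=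
    congrFun (congrArg DFunLike.coe (heq.mfderiv_eq (I := 𝓡 n) (I' := 𝓘(ℝ)))) u
  rw [g.mvfderiv_inner hY hZ, g.mvfderiv_inner hY' hZ, h.self_of_nhds] at hderiv
  linarith

variable [T2Space M]

theorem exists_smoothField_apply_eq (u : TangentSpace (𝓡 n) x) :
    ∃ X : ∀ y : M, TangentSpace (𝓡 n) y, SmoothField X ∧ X x = u := by
  obtain ⟨X, hX, -, hXx⟩ := exists_contMDiff_section_eventuallyEq_extend (n := n)
    (F := EuclideanSpace ℝ (Fin n)) x u
  exact ⟨X, hX, hXx⟩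

end VectorFields

variable {F : Type*} [NormedAddCommGroup F] [NormedSpace ℂ F]
  {V : M → Type*} [TopologicalSpace (TotalSpace F V)]
  [∀ x, AddCommGroup (V x)] [∀ x, Module ℂ (V x)] [∀ x, TopologicalSpace (V x)]
  [∀ x, IsTopologicalAddGroup (V x)] [∀ x, ContinuousSMul ℝ (V x)]
  [FiberBundle F V] {s t : ∀ x : M, V x}
  {A : CovariantDerivative (𝓡 n) F V}

variable (A) in
theorem connection_add (hs : SmoothSection (n := n) F s) (ht : SmoothSection (n := n) F t)
    (u : TangentSpace (𝓡 n) x) : A (fun y ↦ s y + t y) x u = A s x u + A t x u :=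
  congrFun (congrArg DFunLike.coe (A.isCovariantDerivativeOnUniv.add (hs.mdifferentiableAt x)
    (ht.mdifferentiableAt x))) u

variable (A) in
theorem connection_smul {f : M → ℝ} (hf : ContMDiff (𝓡 n) 𝓘(ℝ) ∞ f)
    (hs : SmoothSection (n := n) F s) (u : TangentSpace (𝓡 n) x) :
    A (fun y ↦ f y • s y) x u = f x • A s x u + mvfderiv (𝓡 n) f x u • s x :=
  congrFun (congrArg DFunLike.coe (A.isCovariantDerivativeOnUniv.leibniz (hs.mdifferentiableAt x)
    (hf.mdifferentiableAt (by simp)))) u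

variable [IsManifold (𝓡 n) ∞ M] [VectorBundle ℝ F V]

theorem IsConnection.smoothSection (hA : IsConnection A) {X : ∀ x : M, TangentSpace (𝓡 n) x}
    (hX : SmoothField X) (hs : SmoothSection (n := n) F s) :
    SmoothSection (n := n) F fun y ↦ A s y (X y) := by
  have h := hA.smooth.contMDiff.contMDiff (σ := s) (ContMDiff.contMDiffOn hs)
  rw [contMDiffOn_univ] at h
  exact ContMDiff.clm_bundle_apply (F₁ := EuclideanSpace ℝ (Fin n)) h hX

variable {g : SemiRiemannianMetric n M}

theorem isTensorialAt_hessian (g : SemiRiemannianMetric n M) (hA : IsConnection A)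
    (hs : SmoothSection (n := n) F s) (u : TangentSpace (𝓡 n) x) :
    IsTensorialAt (n := n) (EuclideanSpace ℝ (Fin n)) x
      fun Y : ∀ y : M, TangentSpace (𝓡 n) y ↦
        A (fun y ↦ A s y (Y y)) x u - A s x (g.leviCivita Y x u) where
  add X Y hX hY := by
    have hXY : g.leviCivita (fun y ↦ X y + Y y) x u = _ :=
      g.leviCivita_add (SmoothField.mdifferentiableAt hX x) (SmoothField.mdifferentiableAt hY x) u
    simp only [hXY, map_add, connection_add A (hA.smoothSection hX hs) (hA.smoothSection hY hs)]
    abel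
  smul f X hf hX := by
    have hfX : g.leviCivita (fun y ↦ f y • X y) x u = _ :=
      g.leviCivita_smul (hf.mdifferentiableAt (by simp)) (SmoothField.mdifferentiableAt hX x) u
    simp only [hfX, map_add, map_smul, connection_smul A hf (hA.smoothSection hX hs)]
    module

variable [T2Space M]

theorem hessian_eq (hA : IsConnection A) (hs : SmoothSection (n := n) F s)
    {Y : ∀ x : M, TangentSpace (𝓡 n) x} (hY : SmoothField Y) (u : TangentSpace (𝓡 n) x) :
    hessian g A s x u (Y x) = A (fun y ↦ A s y (Y y)) x u - A s x (g.leviCivita Y x u) := by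
  obtain ⟨Z, hZ, hZext, hZx⟩ := exists_contMDiff_section_eventuallyEq_extend (n := n)
    (F := EuclideanSpace ℝ (Fin n)) x (Y x)
  rw [(isTensorialAt_hessian g hA hs u).congr hY hZ hZx.symm, hessian]
  have hdiff := (hA.smoothSection hZ hs).mdifferentiableAt x
  have hext : ∀ᶠ y in 𝓝 x, A s y (FiberBundle.extend (EuclideanSpace ℝ (Fin n)) (Y x) y)
      = A s y (Z y) := hZext.mono fun y hy ↦ by rw [hy]
  rw [g.leviCivita_congr (SmoothField.mdifferentiableAt hZ x)
      (FiberBundle.mdifferentiableAt_extend (𝓡 n) (EuclideanSpace ℝ (Fin n)) (Y x)) hZext,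
    A.isCovariantDerivativeOnUniv.congr_of_eventuallyEq (hdiff.congr_of_eventuallyEq
      (hext.mono fun y hy ↦ congrArg (TotalSpace.mk' F y) hy)) hdiff univ_mem hext]

/-- The second covariant derivative of a smooth section as a bilinear map on tangent vectors. -/
def hessianBilin (g : SemiRiemannianMetric n M) (hA : IsConnection A)
    (hs : SmoothSection (n := n) F s) (x : M) :
    TangentSpace (𝓡 n) x →ₗ[ℝ] TangentSpace (𝓡 n) x →ₗ[ℝ] V x :=
  LinearMap.mk₂ ℝ (hessian g A s x)
    (fun u u' v ↦ by
      obtain ⟨Y, hY, rfl⟩ := exists_smoothField_apply_eq v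
      simp only [hessian_eq hA hs hY, map_add, g.leviCivita_add_left (hY.mdifferentiableAt x)]
      abel)
    (fun c u v ↦ by
      obtain ⟨Y, hY, rfl⟩ := exists_smoothField_apply_eq v
      simp only [hessian_eq hA hs hY, map_smul, smul_sub,
        g.leviCivita_smul_left (hY.mdifferentiableAt x)])
    (fun u v v' ↦ by
      obtain ⟨Y, hY, rfl⟩ := exists_smoothField_apply_eq v
      obtain ⟨Y', hY', rfl⟩ := exists_smoothField_apply_eq v'
      rw [hessian_eq hA hs hY, hessian_eq hA hs hY',
        ← (isTensorialAt_hessian g hA hs u).add _ _ hY hY']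
      exact hessian_eq hA hs (hY.add hY') u)
    (fun c u v ↦ by
      obtain ⟨Y, hY, rfl⟩ := exists_smoothField_apply_eq v
      rw [hessian_eq hA hs hY,
        ← (isTensorialAt_hessian g hA hs u).smul (fun _ ↦ c) _ contMDiff_const hY]
      exact hessian_eq hA hs (SmoothField.smul (f := fun _ ↦ c) contMDiff_const hY) u)

theorem hessianBilin_apply (g : SemiRiemannianMetric n M) (hA : IsConnection A)
    (hs : SmoothSection (n := n) F s) (u v : TangentSpace (𝓡 n) x) :
    hessianBilin g hA hs x u v = hessian g A s x u v := rfl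

theorem hessian_add (hA : IsConnection A) (hs : SmoothSection (n := n) F s)
    (ht : SmoothSection (n := n) F t) (u v : TangentSpace (𝓡 n) x) :
    hessian g A (fun y ↦ s y + t y) x u v = hessian g A s x u v + hessian g A t x u v := by
  obtain ⟨Y, hY, rfl⟩ := exists_smoothField_apply_eq v
  rw [hessian_eq hA hs hY, hessian_eq hA ht hY, hessian_eq hA (hs.add ht) hY]
  simp only [connection_add A hs ht]
  rw [connection_add A (hA.smoothSection hY hs) (hA.smoothSection hY ht)]
  abel

theorem hessian_const_smul [VectorBundle ℂ F V] (hA : IsConnection A) (c : ℂ)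
    (hs : SmoothSection (n := n) F s) (u v : TangentSpace (𝓡 n) x) :
    hessian g A (fun y ↦ c • s y) x u v = c • hessian g A s x u v := by
  obtain ⟨Y, hY, rfl⟩ := exists_smoothField_apply_eq v
  rw [hessian_eq hA hs hY, hessian_eq hA (hs.const_smul c) hY]
  simp only [hA.map_smul c s hs]
  rw [hA.map_smul c _ (hA.smoothSection hY hs), smul_sub]

theorem hessian_smul (hA : IsConnection A) {f : M → ℝ} (hf : ContMDiff (𝓡 n) 𝓘(ℝ) ∞ f)
    (hs : SmoothSection (n := n) F s) (u v : TangentSpace (𝓡 n) x) :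
    hessian g A (fun y ↦ f y • s y) x u v = f x • hessian g A s x u v
      + (g.inner x (g.grad f x) u • A s x v + g.inner x (g.grad f x) v • A s x u
      + g.inner x (g.leviCivita (g.grad f) x u) v • s x) := by
  obtain ⟨Y, hY, rfl⟩ := exists_smoothField_apply_eq v
  have hdf : ContMDiff (𝓡 n) 𝓘(ℝ) ∞ fun y ↦ g.inner y (g.grad f y) (Y y) :=
    g.contMDiff_inner (g.smoothField_grad hf) hY
  rw [hessian_eq hA hs hY, hessian_eq hA (hs.smul hf) hY]
  simp only [connection_smul A hf hs, ← g.inner_grad]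
  rw [connection_add A ((hA.smoothSection hY hs).smul hf) (hs.smul hdf),
    connection_smul A hf (hA.smoothSection hY hs), connection_smul A hdf hs,
    g.mvfderiv_inner ((g.smoothField_grad hf).mdifferentiableAt x) (hY.mdifferentiableAt x),
    ← g.inner_grad]
  module

end Connections

/-! ## Dirac operators and Laplacians -/

section Weitzenboeck

variable {n : ℕ} {M : Type*} [TopologicalSpace M] [ChartedSpace (EuclideanSpace ℝ (Fin n)) M]
  [IsManifold (𝓡 n) ∞ M] {x : M}

namespace SemiRiemannianMetric

variable {g : SemiRiemannianMetric n M} {e : Module.Basis (Fin n) ℝ (TangentSpace (𝓡 n) x)}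
  {d : Fin n → ℝ} (he : g.IsOrthogonal e d)

section Contraction

variable {W : Type*} [AddCommGroup W] [Module ℝ W]

include he

theorem IsOrthogonal.sum_inner_smul_apply (a : TangentSpace (𝓡 n) x →ₗ[ℝ] W)
    (w : TangentSpace (𝓡 n) x) : ∑ i, (d i)⁻¹ • g.inner x (e i) w • a (e i) = a w := by
  conv_rhs => rw [he.eq_sum w]
  simp only [map_sum, map_smul, smul_smul]

theorem IsOrthogonal.sum_apply_self_adjoint
    (B : TangentSpace (𝓡 n) x →ₗ[ℝ] TangentSpace (𝓡 n) x →ₗ[ℝ] W)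
    (S : TangentSpace (𝓡 n) x → TangentSpace (𝓡 n) x)
    (hS : ∀ u v, g.inner x (S u) v = g.inner x (S v) u) :
    ∑ i, (d i)⁻¹ • B (e i) (S (e i)) = ∑ i, (d i)⁻¹ • B (S (e i)) (e i) := by
  calc ∑ i, (d i)⁻¹ • B (e i) (S (e i))
      = ∑ i, ∑ j, ((d i)⁻¹ * (d j)⁻¹ * g.inner x (S (e i)) (e j)) • B (e i) (e j) :=
        Finset.sum_congr rfl fun i _ ↦ by
          conv_lhs => rw [he.eq_sum (S (e i))]
          simp only [map_sum, map_smul, Finset.smul_sum, smul_smul, mul_assoc, g.symm x (e _)]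
    _ = ∑ j, ∑ i, ((d j)⁻¹ * (d i)⁻¹ * g.inner x (S (e j)) (e i)) • B (e i) (e j) := by
        rw [Finset.sum_comm]
        simp only [hS (e _) (e _), mul_comm (d _)⁻¹ (d _)⁻¹]
    _ = ∑ j, (d j)⁻¹ • B (S (e j)) (e j) :=
        Finset.sum_congr rfl fun j _ ↦ by
          conv_rhs => rw [he.eq_sum (S (e j))]
          simp only [map_sum, map_smul, LinearMap.sum_apply, LinearMap.smul_apply,
            Finset.smul_sum, smul_smul, mul_assoc, g.symm x (e _)]

end Contraction

variable (g) [T2Space M] {f : M → ℝ}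

/-- The Hessian `(u, v) ↦ g(∇_u grad f, v)` of a smooth function. -/
def functionHessian (hf : ContMDiff (𝓡 n) 𝓘(ℝ) ∞ f) (x : M) :
    TangentSpace (𝓡 n) x →ₗ[ℝ] TangentSpace (𝓡 n) x →ₗ[ℝ] ℝ :=
  have hgrad : FieldDiffAt (g.grad f) x := (g.smoothField_grad hf).mdifferentiableAt x
  LinearMap.mk₂ ℝ (fun u v ↦ g.inner x (g.leviCivita (g.grad f) x u) v)
    (fun u u' v ↦ by simp [g.leviCivita_add_left hgrad])
    (fun c u v ↦ by simp [g.leviCivita_smul_left hgrad]) (by simp) (by simp)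

/-- The trace of the Hessian of a function. -/
def laplacian (hf : ContMDiff (𝓡 n) 𝓘(ℝ) ∞ f) (x : M) : ℝ :=
  g.contract x (g.functionHessian hf x)

variable {g} in
include he in
theorem IsOrthogonal.laplacian_eq (hf : ContMDiff (𝓡 n) 𝓘(ℝ) ∞ f) :
    g.laplacian hf x = ∑ i, (d i)⁻¹ * g.inner x (g.leviCivita (g.grad f) x (e i)) (e i) :=
  he.contract_eq _

theorem inner_leviCivita_grad_comm (hf : ContMDiff (𝓡 n) 𝓘(ℝ) ∞ f)
    (u v : TangentSpace (𝓡 n) x) : g.inner x (g.leviCivita (g.grad f) x u) v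
      = g.inner x (g.leviCivita (g.grad f) x v) u := by
  obtain ⟨X, hX, rfl⟩ := exists_smoothField_apply_eq u
  obtain ⟨Y, hY, rfl⟩ := exists_smoothField_apply_eq v
  have hgrad : FieldDiffAt (g.grad f) x := (g.smoothField_grad hf).mdifferentiableAt x
  have hYX := g.mvfderiv_inner hgrad (hX.mdifferentiableAt x) (Y x)
  have hXY := g.mvfderiv_inner hgrad (hY.mdifferentiableAt x) (X x)
  have hbracket := mvfderiv_mlieBracket hf hX hY x
  rw [← g.leviCivita_sub_leviCivita (hX.mdifferentiableAt x) (hY.mdifferentiableAt x)] at hbracket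
  simp only [← g.inner_grad f, map_sub] at hbracket
  linarith

end SemiRiemannianMetric

variable {g : SemiRiemannianMetric n M} {e : Module.Basis (Fin n) ℝ (TangentSpace (𝓡 n) x)}
  {d : Fin n → ℝ} (he : g.IsOrthogonal e d)
  {F : Type*} [NormedAddCommGroup F] [NormedSpace ℂ F]
  {V : M → Type*} [TopologicalSpace (TotalSpace F V)]
  [∀ x, AddCommGroup (V x)] [∀ x, Module ℂ (V x)] [∀ x, TopologicalSpace (V x)]
  [FiberBundle F V]

namespace CliffordAction

variable (γ : CliffordAction F V g)

/-- The bilinear map `(u, v) ↦ γ(v^♭) a(u)`, whose metric contraction is the Clifford contraction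
of the one-form `a`. -/
def clBilin (a : TangentSpace (𝓡 n) x →ₗ[ℝ] V x) :
    TangentSpace (𝓡 n) x →ₗ[ℝ] TangentSpace (𝓡 n) x →ₗ[ℝ] V x :=
  LinearMap.mk₂ ℝ (fun u v ↦ γ.cl x v (a u)) (by simp) (by simp) (by simp) (by simp)

include he in
theorem sum_cl_mul_cl_self_adjoint (S : TangentSpace (𝓡 n) x → TangentSpace (𝓡 n) x)
    (hS : ∀ u v, g.inner x (S u) v = g.inner x (S v) u) :
    ∑ i, (d i)⁻¹ • (γ.cl x (e i) * γ.cl x (S (e i)))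
      = (γ.sgn * ∑ i, (d i)⁻¹ * g.inner x (S (e i)) (e i)) • 1 := by
  have hadjoint : ∑ i, (d i)⁻¹ • (γ.cl x (e i) * γ.cl x (S (e i)))
      = ∑ i, (d i)⁻¹ • (γ.cl x (S (e i)) * γ.cl x (e i)) :=
    he.sum_apply_self_adjoint ((LinearMap.mul ℝ _).compl₁₂ (γ.cl x) (γ.cl x)) S hS
  refine smul_right_injective _ (two_ne_zero (α := ℝ)) ?_
  change (2 : ℝ) • _ = (2 : ℝ) • _
  rw [two_smul]
  nth_rewrite 1 [hadjoint]
  rw [← Finset.sum_add_distrib]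
  simp only [← smul_add, cl_mul_add, smul_smul, ← Finset.sum_smul, Finset.mul_sum]
  congr 1
  exact Finset.sum_congr rfl fun i _ ↦ by ring

variable [∀ x, IsTopologicalAddGroup (V x)] [∀ x, ContinuousSMul ℝ (V x)]
  {s t : ∀ x : M, V x}

section Dirac

variable (A : CovariantDerivative (𝓡 n) F V)

theorem dirac_eq_contract (s : ∀ x : M, V x) (x : M) :
    γ.dirac A s x = g.contract x (γ.clBilin (A s x).toLinearMap) := by
  rw [g.contract_eq_sum_apply_reciprocal (frameBasis x)]
  simp only [dirac, act_coframe, coe_frameBasis]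
  rfl

include he in
theorem dirac_eq_sum (s : ∀ x : M, V x) :
    γ.dirac A s x = ∑ i, (d i)⁻¹ • γ.cl x (e i) (A s x (e i)) := by
  rw [dirac_eq_contract, he.contract_eq]
  rfl

theorem dirac_add (hs : SmoothSection (n := n) F s) (ht : SmoothSection (n := n) F t) (x : M) :
    γ.dirac A (fun y ↦ s y + t y) x = γ.dirac A s x + γ.dirac A t x := by
  simp only [dirac, connection_add A hs ht, map_add, Finset.sum_add_distrib]

theorem dirac_smul {f : M → ℝ} (hf : ContMDiff (𝓡 n) 𝓘(ℝ) ∞ f)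
    (hs : SmoothSection (n := n) F s) (x : M) :
    γ.dirac A (fun y ↦ f y • s y) x = f x • γ.dirac A s x + γ.cl x (g.grad f x) (s x) := by
  obtain ⟨e, d, he⟩ := g.exists_isOrthogonal x
  have hgrad := congrArg (· (s x)) (he.sum_inner_smul_apply (γ.cl x) (g.grad f x))
  simp only [LinearMap.sum_apply, LinearMap.smul_apply, g.symm x (e _)] at hgrad
  simp only [γ.dirac_eq_sum he, connection_smul A hf hs, ← g.inner_grad, map_add,
    LinearMap.map_smul_of_tower, smul_add, Finset.sum_add_distrib, hgrad, Finset.smul_sum,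
    smul_comm (f x) (d _)⁻¹]

variable [VectorBundle ℝ F V]

theorem dirac_const_smul (hA : IsConnection A) (c : ℂ) (hs : SmoothSection (n := n) F s) (x : M) :
    γ.dirac A (fun y ↦ c • s y) x = c • γ.dirac A s x := by
  simp only [dirac, hA.map_smul c s hs, map_smul, Finset.smul_sum]

theorem smoothSection_dirac [T2Space M] (hA : IsConnection A)
    (hs : SmoothSection (n := n) F s) : SmoothSection (n := n) F (γ.dirac A s) := by
  have hdirac : γ.dirac A s = fun y ↦ g.contract y (γ.clBilin (A s y).toLinearMap) :=
    funext (γ.dirac_eq_contract A s)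
  rw [hdirac]
  exact g.contMDiff_contract _ fun X Y hX hY ↦ γ.smoothSection_cl hY (hA.smoothSection hX hs)

end Dirac

section BochnerLaplacian

variable [T2Space M] [VectorBundle ℝ F V] {A : CovariantDerivative (𝓡 n) F V}
  (hA : IsConnection A)
  (hs : SmoothSection (n := n) F s)

theorem bochnerLaplacian_eq_contract (x : M) :
    γ.bochnerLaplacian A s x = γ.sgn • g.contract x (hessianBilin g hA hs x) := rfl

include he hA hs in
theorem bochnerLaplacian_eq_sum :
    γ.bochnerLaplacian A s x = γ.sgn • ∑ i, (d i)⁻¹ • hessian g A s x (e i) (e i) := by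
  rw [γ.bochnerLaplacian_eq_contract hA hs, he.contract_eq]
  rfl

include hA hs in
theorem smoothSection_bochnerLaplacian :
    SmoothSection (n := n) F (γ.bochnerLaplacian A s) := by
  have hcontract : SmoothSection (n := n) F fun y ↦ g.contract y (hessianBilin g hA hs y) :=
    g.contMDiff_contract _ fun X Y hX hY ↦ by
      simp only [hessianBilin_apply, hessian_eq hA hs hY]
      exact (hA.smoothSection hX (hA.smoothSection hY hs)).sub
        (hA.smoothSection (g.smoothField_leviCivita hX hY) hs)
  exact hcontract.smul (f := fun _ ↦ γ.sgn) contMDiff_const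

include hA hs in
theorem bochnerLaplacian_add (ht : SmoothSection (n := n) F t) (x : M) :
    γ.bochnerLaplacian A (fun y ↦ s y + t y) x
      = γ.bochnerLaplacian A s x + γ.bochnerLaplacian A t x := by
  simp only [bochnerLaplacian, hessian_add hA hs ht, smul_add, Finset.sum_add_distrib]

include hA hs in
theorem bochnerLaplacian_const_smul [VectorBundle ℂ F V] (c : ℂ) (x : M) :
    γ.bochnerLaplacian A (fun y ↦ c • s y) x = c • γ.bochnerLaplacian A s x := by
  simp only [bochnerLaplacian, hessian_const_smul hA c hs, Finset.smul_sum, smul_comm _ c]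

include hA hs in
theorem bochnerLaplacian_smul {f : M → ℝ} (hf : ContMDiff (𝓡 n) 𝓘(ℝ) ∞ f) (x : M) :
    γ.bochnerLaplacian A (fun y ↦ f y • s y) x = f x • γ.bochnerLaplacian A s x
      + ((2 * γ.sgn) • A s x (g.grad f x) + (γ.sgn * g.laplacian hf x) • s x) := by
  obtain ⟨e, d, he⟩ := g.exists_isOrthogonal x
  have hgrad : ∑ i, (d i)⁻¹ • g.inner x (e i) (g.grad f x) • A s x (e i) = A s x (g.grad f x) :=
    he.sum_inner_smul_apply (A s x).toLinearMap _
  have htrace : ∑ i, (d i)⁻¹ • hessian g A (fun y ↦ f y • s y) x (e i) (e i)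
      = f x • ∑ i, (d i)⁻¹ • hessian g A s x (e i) (e i)
        + ((2 : ℝ) • A s x (g.grad f x) + g.laplacian hf x • s x) := by
    rw [← hgrad, he.laplacian_eq]
    simp only [hessian_smul hA hf hs, g.symm x (g.grad f x), Finset.smul_sum, Finset.sum_smul,
      ← Finset.sum_add_distrib]
    exact Finset.sum_congr rfl fun i _ ↦ by module
  rw [γ.bochnerLaplacian_eq_sum he hA hs, γ.bochnerLaplacian_eq_sum he hA (hs.smul hf), htrace]
  module

end BochnerLaplacian

section Defect

variable (A : CovariantDerivative (𝓡 n) F V) (s : ∀ x : M, V x)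

/-- The failure `[∇_u, γ(Y^♭)]s - γ((∇_u Y)^♭)s` of `A` to be a Clifford connection. -/
def defect (Y : ∀ x : M, TangentSpace (𝓡 n) x) (x : M) (u : TangentSpace (𝓡 n) x) : V x :=
  A (fun y ↦ γ.cl y (Y y) (s y)) x u - γ.cl x (Y x) (A s x u) - γ.cl x (g.leviCivita Y x u) (s x)

include he in
theorem dirac_cl_grad [T2Space M] {f : M → ℝ} (hf : ContMDiff (𝓡 n) 𝓘(ℝ) ∞ f) :
    γ.dirac A (fun y ↦ γ.cl y (g.grad f y) (s y)) x + γ.cl x (g.grad f x) (γ.dirac A s x)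
      = (2 * γ.sgn) • A s x (g.grad f x) + (γ.sgn * g.laplacian hf x) • s x
        + ∑ i, (d i)⁻¹ • γ.cl x (e i) (γ.defect A s (g.grad f) x (e i)) := by
  have hgrad : ∑ i, (d i)⁻¹ • g.inner x (e i) (g.grad f x) • A s x (e i) = A s x (g.grad f x) :=
    he.sum_inner_smul_apply (A s x).toLinearMap _
  have hlaplacian := congrArg (· (s x)) (γ.sum_cl_mul_cl_self_adjoint he _
    (g.inner_leviCivita_grad_comm (x := x) hf))
  simp only [LinearMap.sum_apply, LinearMap.smul_apply, Module.End.mul_apply,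
    Module.End.one_apply, ← he.laplacian_eq hf] at hlaplacian
  have hclifford (i : Fin n) : γ.cl x (g.grad f x) (γ.cl x (e i) (A s x (e i)))
      = (2 * γ.sgn * g.inner x (e i) (g.grad f x)) • A s x (e i)
        - γ.cl x (e i) (γ.cl x (g.grad f x) (A s x (e i))) :=
    eq_sub_of_add_eq' (congrArg (· (A s x (e i))) (γ.cl_mul_add (e i) (g.grad f x)))
  rw [← hlaplacian, ← hgrad, γ.dirac_eq_sum he, γ.dirac_eq_sum he, map_sum, Finset.smul_sum,
    ← Finset.sum_add_distrib, ← Finset.sum_add_distrib, ← Finset.sum_add_distrib]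
  refine Finset.sum_congr rfl fun i _ ↦ ?_
  simp only [defect, map_sub, LinearMap.map_smul_of_tower, hclifford]
  module

end Defect

end CliffordAction

end Weitzenboeck

/-! ## Bochner connections -/

section BochnerConnections

variable {n : ℕ} {M : Type*} [TopologicalSpace M] [ChartedSpace (EuclideanSpace ℝ (Fin n)) M]
  [IsManifold (𝓡 n) ∞ M] {g : SemiRiemannianMetric n M} {x : M}

theorem SemiRiemannianMetric.exists_grad_eq [T2Space M] (g : SemiRiemannianMetric n M)
    (u : TangentSpace (𝓡 n) x) : ∃ f : M → ℝ, ContMDiff (𝓡 n) 𝓘(ℝ) ∞ f ∧ g.grad f x = u := by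
  obtain ⟨f, hf, hfx⟩ := exists_contMDiff_mvfderiv_eq (n := n) x (g.inner x u)
  exact ⟨f, hf, g.ext_inner fun w ↦ by rw [g.inner_grad, hfx]⟩

variable {F : Type*} [NormedAddCommGroup F] [NormedSpace ℂ F]
  {V : M → Type*} [TopologicalSpace (TotalSpace F V)]
  [∀ x, AddCommGroup (V x)] [∀ x, Module ℂ (V x)] [∀ x, TopologicalSpace (V x)]
  [FiberBundle F V]

section Tensoriality

variable [T2Space M] [VectorBundle ℝ F V] [ContMDiffVectorBundle ∞ F V (𝓡 n)]

variable (F) in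
theorem exists_smoothSection_apply_eq (v : V x) :
    ∃ s : ∀ y : M, V y, SmoothSection (n := n) F s ∧ s x = v := by
  obtain ⟨s, hs, -, hsx⟩ := exists_contMDiff_section_eventuallyEq_extend (n := n) (F := F) x v
  exact ⟨s, hs, hsx⟩

theorem end_ext_of_smoothSection {R S : Module.End ℂ (V x)}
    (h : ∀ s : ∀ y : M, V y, SmoothSection (n := n) F s → R (s x) = S (s x)) : R = S := by
  ext v
  obtain ⟨s, hs, rfl⟩ := exists_smoothSection_apply_eq (n := n) F v
  exact h s hs

variable [VectorBundle ℂ F V] [FiniteDimensional ℂ F]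

theorem IsTensorialAt.exists_complexLinearMap {W : Type*} [AddCommGroup W] [Module ℂ W]
    {P : (∀ y : M, V y) → W} (hP : IsTensorialAt (n := n) F x P)
    (hconst : ∀ (c : ℂ) s, SmoothSection (n := n) F s → P (fun y ↦ c • s y) = c • P s) :
    ∃ L : V x →ₗ[ℂ] W, ∀ s, SmoothSection (n := n) F s → P s = L (s x) := by
  obtain ⟨L, hL⟩ := hP.exists_linearMap
  refine ⟨{ L with map_smul' := fun c v ↦ ?_ }, hL⟩
  obtain ⟨s, hs, rfl⟩ := exists_smoothSection_apply_eq (n := n) F v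
  exact (hL _ (hs.const_smul c)).symm.trans ((hconst c s hs).trans (congrArg (c • ·) (hL s hs)))

theorem exists_smoothEnd_of_isTensorialAt {P : (∀ y : M, V y) → ∀ y : M, V y}
    (hsmooth : ∀ s, SmoothSection (n := n) F s → SmoothSection (n := n) F (P s))
    (htensorial : ∀ x, IsTensorialAt (n := n) F x fun s ↦ P s x)
    (hconst : ∀ (c : ℂ) s, SmoothSection (n := n) F s →
      ∀ x, P (fun y ↦ c • s y) x = c • P s x) :
    ∃ Φ : ∀ x : M, Module.End ℂ (V x), SmoothEnd (n := n) F Φ ∧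
      ∀ s, SmoothSection (n := n) F s → ∀ x, P s x = Φ x (s x) := by
  choose Φ hΦ using fun x ↦ (htensorial x).exists_complexLinearMap fun c s hs ↦ hconst c s hs x
  refine ⟨Φ, fun s hs ↦ ?_, fun s hs x ↦ hΦ x s hs⟩
  have hP : P s = fun x ↦ Φ x (s x) := funext fun x ↦ hΦ x s hs
  exact hP ▸ hsmooth s hs

end Tensoriality

namespace CliffordAction

variable {γ : CliffordAction F V g} {μ : g.VolumeForm} {χ : ∀ x : M, Module.End ℂ (V x)}
  {D : (∀ x : M, V x) → ∀ x : M, V x} (hD : γ.IsDiracType μ χ D) {s : ∀ x : M, V x}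

section DiracType

variable {f : M → ℝ} (hf : ContMDiff (𝓡 n) 𝓘(ℝ) ∞ f) (hs : SmoothSection (n := n) F s)

include hD hf hs

theorem IsDiracType.apply_smul :
    D (fun y ↦ f y • s y) = fun y ↦ f y • D s y + γ.cl y (g.grad f y) (s y) := by
  simp only [hD.symbol f s hf hs, cl_apply, g.inner_grad]

theorem IsDiracType.sq_apply_smul [T2Space M] [VectorBundle ℝ F V] (x : M) :
    D (D (fun y ↦ f y • s y)) x = f x • D (D s) x
      + (γ.cl x (g.grad f x) (D s x) + D (fun y ↦ γ.cl y (g.grad f y) (s y)) x) := by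
  rw [hD.apply_smul hf hs, hD.map_add _ _ ((hD.smooth s hs).smul hf)
    (γ.smoothSection_cl (g.smoothField_grad hf) hs), hD.apply_smul hf (hD.smooth s hs)]
  exact add_assoc _ _ _

end DiracType

variable [∀ x, IsTopologicalAddGroup (V x)] [∀ x, ContinuousSMul ℝ (V x)] [T2Space M]
  [VectorBundle ℝ F V]
  {A A' : CovariantDerivative (𝓡 n) F V}

section GradientAnticommutator

include hD

theorem IsBochnerConnection.cl_grad_add (hB : γ.IsBochnerConnection D A)
    {f : M → ℝ} (hf : ContMDiff (𝓡 n) 𝓘(ℝ) ∞ f) (hs : SmoothSection (n := n) F s) (x : M) :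
    γ.cl x (g.grad f x) (D s x) + D (fun y ↦ γ.cl y (g.grad f y) (s y)) x
      = (2 * γ.sgn) • A s x (g.grad f x) + (γ.sgn * g.laplacian hf x) • s x := by
  obtain ⟨hA, R, -, hR⟩ := hB
  have hRf := hR _ (hs.smul hf) x
  rw [hD.sq_apply_smul hf hs, γ.bochnerLaplacian_smul hA hs hf, LinearMap.map_smul_of_tower,
    ← hR s hs x, ← sub_eq_zero] at hRf
  rw [← sub_eq_zero, ← hRf]
  module

theorem IsBochnerConnection.unique (hB : γ.IsBochnerConnection D A)
    (hB' : γ.IsBochnerConnection D A') (hs : SmoothSection (n := n) F s) : A s = A' s := by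
  ext x u
  obtain ⟨f, hf, rfl⟩ := g.exists_grad_eq u
  exact smul_right_injective _ (mul_ne_zero two_ne_zero γ.sgn_ne_zero) <|
    add_right_cancel <| (hB.cl_grad_add hD hf hs x).symm.trans (hB'.cl_grad_add hD hf hs x)

variable [VectorBundle ℂ F V] [ContMDiffVectorBundle ∞ F V (𝓡 n)] [FiniteDimensional ℂ F]

theorem IsDiracType.isBochnerConnection_of_cl_grad_add (hA : IsConnection A)
    (h : ∀ (f : M → ℝ) (hf : ContMDiff (𝓡 n) 𝓘(ℝ) ∞ f) (s : ∀ x : M, V x),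
      SmoothSection (n := n) F s → ∀ x,
      γ.cl x (g.grad f x) (D s x) + D (fun y ↦ γ.cl y (g.grad f y) (s y)) x
        = (2 * γ.sgn) • A s x (g.grad f x) + (γ.sgn * g.laplacian hf x) • s x) :
    γ.IsBochnerConnection D A := by
  refine ⟨hA, exists_smoothEnd_of_isTensorialAt
    (P := fun s x ↦ D (D s) x - γ.bochnerLaplacian A s x)
    (fun s hs ↦ (hD.smooth _ (hD.smooth s hs)).sub (γ.smoothSection_bochnerLaplacian hA hs))
    (fun x ↦ ⟨fun s t hs ht ↦ ?_, fun f s hf hs ↦ ?_⟩) fun c s hs x ↦ ?_⟩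
  · simp only [hD.map_add s t hs ht, hD.map_add _ _ (hD.smooth s hs) (hD.smooth t ht),
      γ.bochnerLaplacian_add hA hs ht, add_sub_add_comm]
  · simp only [hD.sq_apply_smul hf hs, γ.bochnerLaplacian_smul hA hs hf, h f hf s hs]
    module
  · simp only [hD.map_smul c s hs, hD.map_smul c _ (hD.smooth s hs),
      γ.bochnerLaplacian_const_smul hA hs c, smul_sub]

theorem IsDiracType.exists_eq_dirac_add (hA : IsConnection A) :
    ∃ Φ : ∀ x : M, Module.End ℂ (V x), SmoothEnd (n := n) F Φ ∧
      ∀ s, SmoothSection (n := n) F s → ∀ x, D s x = γ.dirac A s x + Φ x (s x) := by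
  obtain ⟨Φ, hΦ, hDΦ⟩ := exists_smoothEnd_of_isTensorialAt
    (P := fun s x ↦ D s x - γ.dirac A s x)
    (fun s hs ↦ (hD.smooth s hs).sub (γ.smoothSection_dirac A hA hs))
    (fun x ↦ ⟨fun s t hs ht ↦ by
        simp only [hD.map_add s t hs ht, γ.dirac_add A hs ht, add_sub_add_comm],
      fun f s hf hs ↦ by
        simp only [hD.apply_smul hf hs, γ.dirac_smul A hf hs]
        module⟩)
    (fun c s hs x ↦ by simp only [hD.map_smul c s hs, γ.dirac_const_smul A hA c hs, smul_sub])
  exact ⟨Φ, hΦ, fun s hs x ↦ by rw [← hDΦ s hs x]; abel⟩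

end GradientAnticommutator

section ZerothOrderPart

omit [T2Space M] in
theorem IsCliffordConnection.defect_eq_zero (hA : γ.IsCliffordConnection A)
    {Y : ∀ x : M, TangentSpace (𝓡 n) x} (hY : SmoothField Y) (hs : SmoothSection (n := n) F s)
    (x : M) (u : TangentSpace (𝓡 n) x) : γ.defect A s Y x u = 0 := by
  simp only [defect, cl_apply, hA.compatible Y s hY hs x u, add_sub_cancel_left, sub_self]

variable {Φ : ∀ x : M, Module.End ℂ (V x)}
  (hΦ : ∀ s, SmoothSection (n := n) F s → ∀ x, D s x = γ.dirac A s x + Φ x (s x))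

include hD hΦ

theorem IsBochnerConnection.cl_grad_add_add_sum_defect_eq_zero (hB : γ.IsBochnerConnection D A)
    {e : Module.Basis (Fin n) ℝ (TangentSpace (𝓡 n) x)} {d : Fin n → ℝ} (he : g.IsOrthogonal e d)
    {f : M → ℝ} (hf : ContMDiff (𝓡 n) 𝓘(ℝ) ∞ f) (hs : SmoothSection (n := n) F s) :
    γ.cl x (g.grad f x) (Φ x (s x)) + Φ x (γ.cl x (g.grad f x) (s x))
      + ∑ i, (d i)⁻¹ • γ.cl x (e i) (γ.defect A s (g.grad f) x (e i)) = 0 := by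
  have hB := hB.cl_grad_add hD hf hs x
  rw [hΦ s hs, hΦ _ (γ.smoothSection_cl (g.smoothField_grad hf) hs), map_add] at hB
  linear_combination (norm := module) hB - γ.dirac_cl_grad he A s hf

variable [VectorBundle ℂ F V] [ContMDiffVectorBundle ∞ F V (𝓡 n)] [FiniteDimensional ℂ F]

theorem IsCliffordConnection.isBochnerConnection (hA : γ.IsCliffordConnection A)
    (hanti : ∀ (x : M) (u : TangentSpace (𝓡 n) x), Φ x * γ.cl x u = -(γ.cl x u * Φ x)) :
    γ.IsBochnerConnection D A := by
  refine hD.isBochnerConnection_of_cl_grad_add hA.isConnection fun f hf s hs x ↦ ?_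
  obtain ⟨e, d, he⟩ := g.exists_isOrthogonal x
  have hcl_Φ := congrArg (· (s x)) (hanti x (g.grad f x))
  simp only [Module.End.mul_apply, LinearMap.neg_apply] at hcl_Φ
  have hdirac := γ.dirac_cl_grad he A s hf
  simp only [hA.defect_eq_zero (g.smoothField_grad hf) hs, map_zero, smul_zero,
    Finset.sum_const_zero, add_zero] at hdirac
  rw [hΦ s hs, hΦ _ (γ.smoothSection_cl (g.smoothField_grad hf) hs), hcl_Φ, map_add, ← hdirac]
  abel

end ZerothOrderPart

end CliffordAction

end BochnerConnections

/-! ## Operators of simple type -/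

section SimpleTypeOperators

variable {n : ℕ} {M : Type*} [TopologicalSpace M] [ChartedSpace (EuclideanSpace ℝ (Fin n)) M]
  [IsManifold (𝓡 n) ∞ M] {g : SemiRiemannianMetric n M} {x : M}
  {F : Type*} [NormedAddCommGroup F] [NormedSpace ℂ F]
  {V : M → Type*} [TopologicalSpace (TotalSpace F V)]
  [∀ x, AddCommGroup (V x)] [∀ x, Module ℂ (V x)] [∀ x, TopologicalSpace (V x)]
  [FiberBundle F V]

namespace CliffordAction

variable {γ : CliffordAction F V g} {μ : g.VolumeForm} {χ φ φ' : ∀ x : M, Module.End ℂ (V x)}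
  {D : (∀ x : M, V x) → ∀ x : M, V x} {s : ∀ x : M, V x}

theorem CommutesWithClifford.chirality_mul_mul_cl (hφ : γ.CommutesWithClifford φ)
    (μ : g.VolumeForm) (hn : Even n) (u : TangentSpace (𝓡 n) x) :
    γ.chirality μ x * φ x * γ.cl x u = -(γ.cl x u * (γ.chirality μ x * φ x)) := by
  have hφu : Commute (γ.cl x u) (φ x) := hφ x (g.inner x u)
  rw [mul_assoc, ← hφu.eq, ← mul_assoc, γ.chirality_mul_cl μ hn, neg_mul, mul_assoc]

theorem CommutesWithClifford.commute_chirality (hφ : γ.CommutesWithClifford φ)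
    (μ : g.VolumeForm) (x : M) : Commute (γ.chirality μ x) (φ x) := by
  refine Commute.smul_left (Commute.smul_left (Commute.sum_left _ _ _ fun σ _ ↦
    Commute.smul_left (Commute.list_prod_left _ _ fun T hT ↦ ?_) _) _) _
  obtain ⟨i, rfl⟩ := List.mem_ofFn.1 hT
  exact hφ x _

theorem IsTwistInvolution.grading_cl (hχ : γ.IsTwistInvolution χ) (μ : g.VolumeForm)
    (hn : Even n) (u : TangentSpace (𝓡 n) x) (v : V x) :
    γ.grading μ χ x (γ.cl x u v) = -γ.cl x u (γ.grading μ χ x v) :=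
  congrArg (· v) (hχ.commutes.chirality_mul_mul_cl μ hn u)

variable [T2Space M] [VectorBundle ℝ F V] [VectorBundle ℂ F V]

theorem IsTwistInvolution.smoothEnd_grading (hχ : γ.IsTwistInvolution χ) (μ : g.VolumeForm) :
    SmoothEnd (n := n) F (γ.grading μ χ) :=
  fun s hs ↦ γ.smoothEnd_chirality μ _ (hχ.smooth s hs)

variable [∀ x, IsTopologicalAddGroup (V x)] [∀ x, ContinuousSMul ℝ (V x)]
  {A A' : CovariantDerivative (𝓡 n) F V}

section Grading

variable (hn : Even n) (hχ : γ.IsTwistInvolution χ) (hD : γ.IsDiracType μ χ D)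

include hn hχ hD

-- The grading anticommutes with both `D` and `γ(df)`, hence commutes with `Dγ(df) + γ(df)D`,
-- which determines the Bochner connection.
theorem IsBochnerConnection.apply_grading (hB : γ.IsBochnerConnection D A)
    (hs : SmoothSection (n := n) F s) (x : M) (u : TangentSpace (𝓡 n) x) :
    A (fun y ↦ γ.grading μ χ y (s y)) x u = γ.grading μ χ x (A s x u) := by
  obtain ⟨f, hf, rfl⟩ := g.exists_grad_eq u
  have hΓ := hχ.smoothEnd_grading μ
  have hcl := γ.smoothSection_cl (g.smoothField_grad hf) hs
  have hDcl : D (fun y ↦ γ.cl y (g.grad f y) (γ.grading μ χ y (s y)))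
      = fun y ↦ γ.grading μ χ y (D (fun z ↦ γ.cl z (g.grad f z) (s z)) y) := by
    have hneg : (fun y ↦ γ.cl y (g.grad f y) (γ.grading μ χ y (s y)))
        = fun y ↦ (-1 : ℂ) • γ.grading μ χ y (γ.cl y (g.grad f y) (s y)) := by
      simp only [hχ.grading_cl μ hn, neg_one_smul, neg_neg]
    rw [hneg, hD.map_smul (-1) _ (hΓ _ hcl), hD.odd _ hcl]
    simp only [neg_one_smul, neg_neg]
  have hΓB := congrArg (γ.grading μ χ x) (hB.cl_grad_add hD hf hs x)
  have hBΓ := hB.cl_grad_add hD hf (hΓ s hs) x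
  simp only [hDcl, hD.odd s hs, map_neg] at hBΓ
  simp only [map_add, hχ.grading_cl μ hn, LinearMap.map_smul_of_tower] at hΓB
  exact smul_right_injective _ (mul_ne_zero two_ne_zero γ.sgn_ne_zero)
    (add_right_cancel (hBΓ.symm.trans hΓB))

variable [ContMDiffVectorBundle ∞ F V (𝓡 n)]

theorem IsBochnerConnection.mul_grading (hB : γ.IsBochnerConnection D A)
    {Φ : ∀ x : M, Module.End ℂ (V x)}
    (hΦ : ∀ s, SmoothSection (n := n) F s → ∀ x, D s x = γ.dirac A s x + Φ x (s x)) (x : M) :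
    Φ x * γ.grading μ χ x = -(γ.grading μ χ x * Φ x) := by
  refine end_ext_of_smoothSection (n := n) (F := F) fun s hs ↦ ?_
  have hΓ := hχ.smoothEnd_grading μ
  have hdirac : γ.dirac A (fun y ↦ γ.grading μ χ y (s y)) x
      = -γ.grading μ χ x (γ.dirac A s x) := by
    simp only [dirac, hB.apply_grading hn hχ hD hs, act_eq_cl_sharp, map_sum,
      hχ.grading_cl μ hn, Finset.sum_neg_distrib, neg_neg]
  have hodd := congrFun (hD.odd s hs) x
  simp only [hΦ _ (hΓ s hs), hΦ s hs, hdirac, map_add, neg_add] at hodd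
  exact add_left_cancel hodd

end Grading

variable [ContMDiffVectorBundle ∞ F V (𝓡 n)] (hn : Even n) (hD : γ.IsDiracType μ χ D)

include hD

omit [VectorBundle ℂ F V] in
theorem IsCliffordConnection.mul_cl_of_isBochnerConnection (hA : γ.IsCliffordConnection A)
    (hB : γ.IsBochnerConnection D A) {Φ : ∀ x : M, Module.End ℂ (V x)}
    (hΦ : ∀ s, SmoothSection (n := n) F s → ∀ x, D s x = γ.dirac A s x + Φ x (s x))
    (u : TangentSpace (𝓡 n) x) : Φ x * γ.cl x u = -(γ.cl x u * Φ x) := by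
  refine end_ext_of_smoothSection (n := n) (F := F) fun s hs ↦ ?_
  obtain ⟨f, hf, rfl⟩ := g.exists_grad_eq u
  obtain ⟨e, d, he⟩ := g.exists_isOrthogonal x
  have hsum := hB.cl_grad_add_add_sum_defect_eq_zero hD hΦ he hf hs
  simp only [hA.defect_eq_zero (g.smoothField_grad hf) hs, map_zero, smul_zero,
    Finset.sum_const_zero, add_zero] at hsum
  exact eq_neg_of_add_eq_zero_right hsum

variable [FiniteDimensional ℂ F]

include hn

theorem IsCliffordConnection.exists_isOddTwist (hχ : γ.IsTwistInvolution χ)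
    (hA : γ.IsCliffordConnection A) (hB : γ.IsBochnerConnection D A) :
    ∃ φ : ∀ x : M, Module.End ℂ (V x), γ.IsOddTwist μ χ φ ∧ γ.IsSum μ D A φ := by
  obtain ⟨Φ, hΦs, hΦ⟩ := hD.exists_eq_dirac_add hA.isConnection
  have hanti {x : M} (u : TangentSpace (𝓡 n) x) : Φ x * γ.cl x u = -(γ.cl x u * Φ x) :=
    hA.mul_cl_of_isBochnerConnection hD hB hΦ u
  refine ⟨fun x ↦ γ.chirality μ x * Φ x, ⟨fun s hs ↦ γ.smoothEnd_chirality μ _ (hΦs s hs),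
    fun x α ↦ ?_, fun x ↦ ?_⟩, fun s hs x ↦ ?_⟩
  · rw [γ.act_eq_cl_sharp, commute_iff_eq, mul_assoc, hanti, mul_neg, ← mul_assoc, ← mul_assoc,
      γ.chirality_mul_cl μ hn, neg_mul, neg_neg]
  · have hΓ : γ.grading μ χ x * γ.chirality μ x = γ.chirality μ x * γ.grading μ χ x := by
      rw [grading, mul_assoc, (hχ.commutes.commute_chirality μ x).eq]
    rw [← mul_assoc, hΓ, mul_assoc, mul_assoc, hB.mul_grading hn hχ hD hΦ, mul_neg, neg_neg]
  · rw [hΦ s hs, ← Module.End.mul_apply, ← mul_assoc, γ.chirality_mul_self μ hn, one_mul]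

theorem IsSum.isBochnerConnection (hA : γ.IsCliffordConnection A)
    (hφ : γ.CommutesWithClifford φ) (h : γ.IsSum μ D A φ) : γ.IsBochnerConnection D A :=
  hA.isBochnerConnection hD (Φ := fun x ↦ γ.chirality μ x * φ x) h
    fun _ ↦ hφ.chirality_mul_mul_cl μ hn

theorem IsSum.unique (hA : γ.IsCliffordConnection A) (hφ : γ.CommutesWithClifford φ)
    (h : γ.IsSum μ D A φ) (hA' : γ.IsCliffordConnection A') (hφ' : γ.CommutesWithClifford φ')
    (h' : γ.IsSum μ D A' φ') :
    φ = φ' ∧ ∀ s : ∀ x : M, V x, SmoothSection (n := n) F s → A s = A' s := by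
  have hAA' {s : ∀ x : M, V x} (hs : SmoothSection (n := n) F s) : A s = A' s :=
    (h.isBochnerConnection hn hD hA hφ).unique hD (h'.isBochnerConnection hn hD hA' hφ') hs
  refine ⟨funext fun x ↦ end_ext_of_smoothSection (n := n) (F := F) fun s hs ↦ ?_,
    fun s hs ↦ hAA' hs⟩
  have hφφ' : γ.chirality μ x (φ x (s x)) = γ.chirality μ x (φ' x (s x)) := by
    have hsum := (h s hs x).symm.trans (h' s hs x)
    simp only [dirac, hAA' hs] at hsum
    exact add_left_cancel hsum
  have hinvol (v : V x) : γ.chirality μ x (γ.chirality μ x v) = v :=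
    congrArg (· v) (γ.chirality_mul_self μ hn x)
  exact (Function.LeftInverse.injective hinvol) hφφ'

end CliffordAction

end SimpleTypeOperators

/-! ## The Dirac form -/

section DiracForm

variable {n : ℕ} {M : Type*} [TopologicalSpace M] [ChartedSpace (EuclideanSpace ℝ (Fin n)) M]
  [IsManifold (𝓡 n) ∞ M] {g : SemiRiemannianMetric n M} {x : M}
  {F : Type*} [NormedAddCommGroup F] [NormedSpace ℂ F]
  {V : M → Type*} [TopologicalSpace (TotalSpace F V)]
  [∀ x, AddCommGroup (V x)] [∀ x, Module ℂ (V x)] [∀ x, TopologicalSpace (V x)]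
  [FiberBundle F V]

omit [IsManifold (𝓡 n) ∞ M] in
theorem connection_const_smul [∀ x, IsTopologicalAddGroup (V x)] [∀ x, ContinuousSMul ℝ (V x)]
    (A : CovariantDerivative (𝓡 n) F V) {s : ∀ x : M, V x} (c : ℝ)
    (hs : SmoothSection (n := n) F s) (u : TangentSpace (𝓡 n) x) :
    A (fun y ↦ c • s y) x u = c • A s x u :=
  congrFun (congrArg DFunLike.coe (A.isCovariantDerivativeOnUniv.smul_const c
    (hs.mdifferentiableAt x))) u

namespace CliffordAction

section Theta

variable (γ : CliffordAction F V g)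

theorem exists_injective_theta (hn : 0 < n) (x : M) :
    ∃ u, Function.Injective (γ.theta x u) := by
  obtain ⟨e, d, he⟩ := g.exists_isOrthogonal x
  let i : Fin n := ⟨0, hn⟩
  have hcoeff : ((γ.sgn / n : ℝ) : ℂ) ≠ 0 :=
    Complex.ofReal_ne_zero.2 (div_ne_zero γ.sgn_ne_zero (Nat.cast_ne_zero.2 hn.ne'))
  have hsq (v : V x) : γ.cl x (e i) (γ.cl x (e i) v) = (γ.sgn * d i) • v :=
    congrArg (· v) ((γ.isCliffordFamily_cl he).sq i)
  have hcl : Function.Injective (γ.cl x (e i)) := fun v w hvw ↦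
    smul_right_injective _ (mul_ne_zero γ.sgn_ne_zero (he.ne_zero i)) <|
      (hsq v).symm.trans ((congrArg (γ.cl x (e i)) hvw).trans (hsq w))
  exact ⟨e i, fun v w hvw ↦ hcl (smul_right_injective _ hcoeff hvw)⟩

end Theta

variable [∀ x, IsTopologicalAddGroup (V x)] [∀ x, ContinuousSMul ℝ (V x)]

section Defect

variable (γ : CliffordAction F V g) {A : CovariantDerivative (𝓡 n) F V} {s : ∀ x : M, V x}

section Tensoriality

variable (A) in
theorem isTensorialAt_defect_field (hs : SmoothSection (n := n) F s)
    (u : TangentSpace (𝓡 n) x) :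
    IsTensorialAt (n := n) (EuclideanSpace ℝ (Fin n)) x
      fun Y : ∀ y : M, TangentSpace (𝓡 n) y ↦ γ.defect A s Y x u where
  add X Y hX hY := by
    have hXY : g.leviCivita (fun y ↦ X y + Y y) x u = _ :=
      g.leviCivita_add (SmoothField.mdifferentiableAt hX x) (SmoothField.mdifferentiableAt hY x) u
    have hA := connection_add A (γ.smoothSection_cl hX hs) (γ.smoothSection_cl hY hs) u
    simp only [defect, map_add, LinearMap.add_apply, hXY, hA]
    abel
  smul f X hf hX := by
    have hfX : g.leviCivita (fun y ↦ f y • X y) x u = _ :=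
      g.leviCivita_smul (hf.mdifferentiableAt (by simp)) (SmoothField.mdifferentiableAt hX x) u
    have hA := connection_smul A hf (γ.smoothSection_cl hX hs) u
    simp only [defect, map_add, map_smul, LinearMap.add_apply, LinearMap.smul_apply, hfX, hA]
    module

variable {Y : ∀ x : M, TangentSpace (𝓡 n) x} (hY : SmoothField Y)

include hY

variable (A) in
theorem isTensorialAt_defect_section (u : TangentSpace (𝓡 n) x) :
    IsTensorialAt (n := n) F x fun s ↦ γ.defect A s Y x u where
  add s t hs ht := by
    have hA := connection_add A (γ.smoothSection_cl hY hs) (γ.smoothSection_cl hY ht) u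
    simp only [defect, map_add, connection_add A hs ht, hA]
    abel
  smul f s hf hs := by
    have hA := connection_smul A hf (γ.smoothSection_cl hY hs) u
    simp only [defect, map_add, LinearMap.map_smul_of_tower, connection_smul A hf hs, hA]
    module

theorem defect_const_smul [VectorBundle ℝ F V] (hA : IsConnection A) (c : ℂ)
    (hs : SmoothSection (n := n) F s) (u : TangentSpace (𝓡 n) x) :
    γ.defect A (fun y ↦ c • s y) Y x u = c • γ.defect A s Y x u := by
  simp only [defect, map_smul, hA.map_smul c s hs, hA.map_smul c _ (γ.smoothSection_cl hY hs),
    smul_sub]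

variable [T2Space M] [VectorBundle ℝ F V] [ContMDiffVectorBundle ∞ F V (𝓡 n)]
  [VectorBundle ℂ F V] [FiniteDimensional ℂ F]

theorem exists_defect_eq_of_smoothField (hA : IsConnection A) (x : M) :
    ∃ T : TangentSpace (𝓡 n) x →ₗ[ℝ] Module.End ℂ (V x),
      ∀ s, SmoothSection (n := n) F s → ∀ u, γ.defect A s Y x u = T u (s x) := by
  choose T hT using fun u ↦ (γ.isTensorialAt_defect_section A hY (x := x) u).exists_complexLinearMap
    fun c s hs ↦ γ.defect_const_smul hY hA c hs u
  have hd := hY.mdifferentiableAt x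
  refine ⟨{ toFun := T, map_add' := fun u v ↦ ?_, map_smul' := fun c u ↦ ?_ },
    fun s hs u ↦ hT u s hs⟩
  all_goals refine end_ext_of_smoothSection (n := n) (F := F) fun s hs ↦ ?_
  · simp only [LinearMap.add_apply, ← hT _ s hs, defect, map_add, g.leviCivita_add_left hd]
    abel
  · simp only [LinearMap.smul_apply, ← hT _ s hs, defect, map_smul, g.leviCivita_smul_left hd,
      RingHom.id_apply, LinearMap.map_smul_of_tower, smul_sub]

omit hY in
theorem exists_defect_eq (hA : IsConnection A) (x : M) :
    ∃ T : TangentSpace (𝓡 n) x →ₗ[ℝ] TangentSpace (𝓡 n) x →ₗ[ℝ] Module.End ℂ (V x),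
      ∀ Y s, SmoothField Y → SmoothSection (n := n) F s →
        ∀ u, γ.defect A s Y x u = T (Y x) u (s x) := by
  choose E hE hEx using exists_smoothField_apply_eq (n := n) (x := x)
  choose T hT using fun v ↦ γ.exists_defect_eq_of_smoothField (hE v) hA x
  have hTY {Y : ∀ y : M, TangentSpace (𝓡 n) y} (hY : SmoothField Y) {s : ∀ y : M, V y}
      (hs : SmoothSection (n := n) F s) (u : TangentSpace (𝓡 n) x) :
      γ.defect A s Y x u = T (Y x) u (s x) := by
    rw [← hT (Y x) s hs u]
    exact (γ.isTensorialAt_defect_field A hs u).congr hY (hE _) (hEx _).symm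
  refine ⟨LinearMap.mk₂ ℝ (fun v u ↦ T v u) (fun v w u ↦ ?_) (fun c v u ↦ ?_)
    (fun v ↦ map_add (T v)) (fun c v ↦ map_smul (T v) c), fun Y s hY hs ↦ hTY hY hs⟩
  all_goals refine end_ext_of_smoothSection (n := n) (F := F) fun s hs ↦ ?_
  · have hadd := (hTY (SmoothField.add (hE v) (hE w)) hs u).symm.trans
      ((γ.isTensorialAt_defect_field A hs u).add _ _ (hE v) (hE w))
    simp only [hTY (hE v) hs, hTY (hE w) hs, Pi.add_apply, hEx] at hadd
    exact hadd
  · have hsmul := (hTY (SmoothField.smul contMDiff_const (hE v)) hs u).symm.trans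
      ((γ.isTensorialAt_defect_field A hs u).smul _ _ (contMDiff_const (c := c)) (hE v))
    simp only [hTY (hE v) hs, Pi.smul_apply', hEx] at hsmul
    exact hsmul

end Tensoriality

-- The derivative of the Clifford relation along `u`, as `∇g = 0`.
theorem cl_defect_add_defect_cl [VectorBundle ℝ F V] {Y Z : ∀ x : M, TangentSpace (𝓡 n) x}
    (hY : SmoothField Y) (hZ : SmoothField Z) (hs : SmoothSection (n := n) F s)
    (u : TangentSpace (𝓡 n) x) :
    γ.cl x (Y x) (γ.defect A s Z x u) + γ.defect A (fun y ↦ γ.cl y (Y y) (s y)) Z x u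
      = -(γ.cl x (Z x) (γ.defect A s Y x u)
        + γ.defect A (fun y ↦ γ.cl y (Z y) (s y)) Y x u) := by
  have hrel (y : M) (v w : TangentSpace (𝓡 n) y) (ψ : V y) :
      γ.cl y v (γ.cl y w ψ) + γ.cl y w (γ.cl y v ψ) = (2 * γ.sgn * g.inner y v w) • ψ :=
    congrArg (· ψ) (γ.cl_mul_add v w)
  have hf : ContMDiff (𝓡 n) 𝓘(ℝ) ∞ fun y ↦ g.inner y (Y y) (Z y) := g.contMDiff_inner hY hZ
  have hderiv := connection_add A (γ.smoothSection_cl hY (γ.smoothSection_cl hZ hs))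
    (γ.smoothSection_cl hZ (γ.smoothSection_cl hY hs)) u
  simp only [hrel, mul_smul _ (g.inner _ _ _)] at hderiv
  rw [connection_const_smul A _ (hs.smul hf), connection_smul A hf hs,
    g.mvfderiv_inner (hY.mdifferentiableAt x) (hZ.mdifferentiableAt x)] at hderiv
  simp only [defect, map_sub]
  linear_combination (norm := module) -hderiv - hrel x (Y x) (Z x) (A s x u)
    - hrel x (g.leviCivita Y x u) (Z x) (s x) - hrel x (Y x) (g.leviCivita Z x u) (s x)

end Defect

variable [T2Space M] [VectorBundle ℝ F V] [ContMDiffVectorBundle ∞ F V (𝓡 n)]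
  {γ : CliffordAction F V g} {μ : g.VolumeForm} {χ φ : ∀ x : M, Module.End ℂ (V x)}
  {D : (∀ x : M, V x) → ∀ x : M, V x} {A : CovariantDerivative (𝓡 n) F V}

section AnticommutingZeroOrderPart

variable {T : TangentSpace (𝓡 n) x →ₗ[ℝ] TangentSpace (𝓡 n) x →ₗ[ℝ] Module.End ℂ (V x)}
  (hT : ∀ Y s, SmoothField Y → SmoothSection (n := n) F s →
    ∀ u, γ.defect A s Y x u = T (Y x) u (s x))

include hT

theorem cl_mul_defect_add (v w u : TangentSpace (𝓡 n) x) :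
    γ.cl x v * T w u + T w u * γ.cl x v = -(γ.cl x w * T v u + T v u * γ.cl x w) := by
  obtain ⟨Y, hY, rfl⟩ := exists_smoothField_apply_eq v
  obtain ⟨Z, hZ, rfl⟩ := exists_smoothField_apply_eq w
  refine end_ext_of_smoothSection (n := n) (F := F) fun s hs ↦ ?_
  have hskew := γ.cl_defect_add_defect_cl (A := A) hY hZ hs u
  simp only [hT _ _ hZ hs, hT _ _ hY hs, hT _ _ hZ (γ.smoothSection_cl hY hs),
    hT _ _ hY (γ.smoothSection_cl hZ hs)] at hskew
  exact hskew

variable (hD : γ.IsDiracType μ χ D) (hB : γ.IsBochnerConnection D A)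
  {Φ : ∀ x : M, Module.End ℂ (V x)}
  (hΦ : ∀ s, SmoothSection (n := n) F s → ∀ x, D s x = γ.dirac A s x + Φ x (s x))
  (hanti : ∀ u : TangentSpace (𝓡 n) x, Φ x * γ.cl x u = -(γ.cl x u * Φ x))

include hD hB hΦ hanti

theorem sum_cl_mul_defect_eq_zero {e : Module.Basis (Fin n) ℝ (TangentSpace (𝓡 n) x)}
    {d : Fin n → ℝ} (he : g.IsOrthogonal e d) (v : TangentSpace (𝓡 n) x) :
    ∑ i, (d i)⁻¹ • (γ.cl x (e i) * T v (e i)) = 0 := by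
  obtain ⟨f, hf, rfl⟩ := g.exists_grad_eq v
  refine end_ext_of_smoothSection (n := n) (F := F) fun s hs ↦ ?_
  have hΦcl : Φ x (γ.cl x (g.grad f x) (s x)) = -γ.cl x (g.grad f x) (Φ x (s x)) :=
    congrArg (· (s x)) (hanti _)
  have hsum := hB.cl_grad_add_add_sum_defect_eq_zero hD hΦ he hf hs
  simp only [hΦcl, add_neg_cancel, zero_add, hT _ _ (g.smoothField_grad hf) hs] at hsum
  simp only [LinearMap.sum_apply, LinearMap.smul_apply, Module.End.mul_apply]
  exact hsum

theorem defect_eq_zero_of_anticomm : T = 0 := by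
  obtain ⟨e, d, he⟩ := g.exists_isOrthogonal x
  refine e.ext fun k ↦ e.ext fun i ↦ (γ.isCliffordFamily_cl he).eq_zero_of_contraction_eq_zero
    (fun j ↦ mul_ne_zero γ.sgn_ne_zero (he.ne_zero j)) (T := fun i k ↦ T (e k) (e i))
    (fun k ↦ ?_) (fun i j k ↦ cl_mul_defect_add hT _ _ _) i k
  simp only [mul_inv, mul_smul, ← Finset.smul_sum,
    sum_cl_mul_defect_eq_zero hT hD hB hΦ hanti he, smul_zero]

end AnticommutingZeroOrderPart

section Equivalence

variable [VectorBundle ℂ F V] [FiniteDimensional ℂ F]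

theorem IsBochnerConnection.isCliffordConnection (hD : γ.IsDiracType μ χ D)
    (hB : γ.IsBochnerConnection D A) {Φ : ∀ x : M, Module.End ℂ (V x)}
    (hΦ : ∀ s, SmoothSection (n := n) F s → ∀ x, D s x = γ.dirac A s x + Φ x (s x))
    (hanti : ∀ (x : M) (u : TangentSpace (𝓡 n) x), Φ x * γ.cl x u = -(γ.cl x u * Φ x)) :
    γ.IsCliffordConnection A := by
  refine ⟨hB.1, fun Y s hY hs x u ↦ ?_⟩
  obtain ⟨T, hT⟩ := γ.exists_defect_eq hB.1 x
  have hdefect : γ.defect A s Y x u = 0 := by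
    rw [hT Y s hY hs, defect_eq_zero_of_anticomm hT hD hB hΦ (hanti x)]
    rfl
  rw [defect, sub_sub, sub_eq_zero] at hdefect
  exact hdefect

variable (hn : Even n) (hD : γ.IsDiracType μ χ D)

include hn hD

theorem HasDiracForm.exists_isSum (hn0 : 0 < n) (hφ : γ.CommutesWithClifford φ)
    (h : γ.HasDiracForm D fun x u ↦ γ.theta x u * (γ.chirality μ x * φ x)) :
    ∃ A : CovariantDerivative (𝓡 n) F V, γ.IsCliffordConnection A ∧ γ.IsSum μ D A φ := by
  obtain ⟨⟨A, hB⟩, h⟩ := h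
  have hsum : γ.IsSum μ D A φ := fun s hs x ↦ by
    obtain ⟨u, hu⟩ := γ.exists_injective_theta hn0 x
    exact sub_eq_iff_eq_add'.1 (hu (h A hB s hs x u))
  exact ⟨A, hB.isCliffordConnection hD (Φ := fun x ↦ γ.chirality μ x * φ x) hsum
    fun _ ↦ hφ.chirality_mul_mul_cl μ hn, hsum⟩

theorem IsSum.hasDiracForm (hA : γ.IsCliffordConnection A) (hφ : γ.CommutesWithClifford φ)
    (h : γ.IsSum μ D A φ) :
    γ.HasDiracForm D fun x u ↦ γ.theta x u * (γ.chirality μ x * φ x) := by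
  have hB := h.isBochnerConnection hn hD hA hφ
  refine ⟨⟨A, hB⟩, fun A' hB' s hs x u ↦ ?_⟩
  have hdirac : γ.dirac A' s x = γ.dirac A s x := by
    simp only [dirac, hB'.unique hD hB hs]
  rw [hdirac, h s hs, add_sub_cancel_left]
  rfl

theorem IsDiracType.isSimpleType_iff (hχ : γ.IsTwistInvolution χ) :
    γ.IsSimpleType D ↔
      ∃ (A : CovariantDerivative (𝓡 n) F V) (φ : ∀ x : M, Module.End ℂ (V x)),
        γ.IsCliffordConnection A ∧ γ.IsOddTwist μ χ φ ∧ γ.IsSum μ D A φ := by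
  constructor
  · rintro ⟨A, hA, hB⟩
    obtain ⟨φ, hφ, hsum⟩ := hA.exists_isOddTwist hn hD hχ hB
    exact ⟨A, φ, hA, hφ, hsum⟩
  · rintro ⟨A, φ, hA, hφ, hsum⟩
    exact ⟨A, hA, hsum.isBochnerConnection hn hD hA hφ.commutes⟩

theorem IsDiracType.exists_isSum_iff_hasDiracForm (hn0 : 0 < n)
    (hφ : γ.CommutesWithClifford φ) :
    (∃ A : CovariantDerivative (𝓡 n) F V, γ.IsCliffordConnection A ∧ γ.IsSum μ D A φ) ↔
      γ.HasDiracForm D fun x u ↦ γ.theta x u * (γ.chirality μ x * φ x) :=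
  ⟨fun ⟨_, hA, hsum⟩ ↦ hsum.hasDiracForm hn hD hA hφ,
    fun h ↦ h.exists_isSum hn hD hn0 hφ⟩

end Equivalence

end CliffordAction

end DiracForm

end SimpleType

end

theorem mainTheorem1 {n : ℕ} (hn : Even n) (hn0 : 0 < n)
    {M : Type*} [TopologicalSpace M] [ChartedSpace (EuclideanSpace ℝ (Fin n)) M]
    [IsManifold (𝓡 n) ∞ M] [T2Space M] [ParacompactSpace M]
    {F : Type*} [NormedAddCommGroup F] [NormedSpace ℂ F] [FiniteDimensional ℂ F]
    {V : M → Type*} [TopologicalSpace (TotalSpace F V)]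
    [∀ x, AddCommGroup (V x)] [∀ x, Module ℂ (V x)] [∀ x, TopologicalSpace (V x)]
    [∀ x, IsTopologicalAddGroup (V x)] [∀ x, ContinuousSMul ℝ (V x)]
    [FiberBundle F V] [VectorBundle ℂ F V] [VectorBundle ℝ F V]
    [ContMDiffVectorBundle ∞ F V (𝓡 n)]
    (g : SimpleType.SemiRiemannianMetric n M) (μ : g.VolumeForm)
    (γ : SimpleType.CliffordAction F V g)
    (χ : ∀ x : M, Module.End ℂ (V x)) (hχ : γ.IsTwistInvolution χ)
    (D : (∀ x : M, V x) → ∀ x : M, V x) (hD : γ.IsDiracType μ χ D) :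
    (γ.IsSimpleType D ↔
      ∃ (A : CovariantDerivative (𝓡 n) F V) (φ : ∀ x : M, Module.End ℂ (V x)),
        γ.IsCliffordConnection A ∧ γ.IsOddTwist μ χ φ ∧ γ.IsSum μ D A φ) ∧
    (γ.IsSimpleType D ↔
      ∃ φ : ∀ x : M, Module.End ℂ (V x), γ.IsOddTwist μ χ φ ∧
        γ.HasDiracForm D (fun x u ↦ γ.theta x u * (γ.chirality μ x * φ x))) ∧
    (∀ φ : ∀ x : M, Module.End ℂ (V x), γ.IsOddTwist μ χ φ →
      ((∃ A : CovariantDerivative (𝓡 n) F V, γ.IsCliffordConnection A ∧ γ.IsSum μ D A φ) ↔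
        γ.HasDiracForm D (fun x u ↦ γ.theta x u * (γ.chirality μ x * φ x)))) ∧
    (γ.IsSimpleType D →
      ∃! φ : ∀ x : M, Module.End ℂ (V x), γ.IsOddTwist μ χ φ ∧
        γ.HasDiracForm D (fun x u ↦ γ.theta x u * (γ.chirality μ x * φ x))) ∧
    (∀ (A A' : CovariantDerivative (𝓡 n) F V) (φ φ' : ∀ x : M, Module.End ℂ (V x)),
      γ.IsCliffordConnection A → γ.IsOddTwist μ χ φ → γ.IsSum μ D A φ →
      γ.IsCliffordConnection A' → γ.IsOddTwist μ χ φ' → γ.IsSum μ D A' φ' →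
      φ = φ' ∧ ∀ s : ∀ x : M, V x, SimpleType.SmoothSection (n := n) F s → A s = A' s) := by
  have hSimple := hD.isSimpleType_iff hn hχ
  have hForm φ (hφ : γ.IsOddTwist μ χ φ) := hD.exists_isSum_iff_hasDiracForm hn hn0 hφ.commutes
  refine ⟨hSimple, ⟨fun h ↦ ?_, fun ⟨φ, hφ, h⟩ ↦ ?_⟩, hForm, fun h ↦ ?_,
    fun A A' φ φ' hA hφ h hA' hφ' h' ↦ h.unique hn hD hA hφ.commutes hA' hφ'.commutes h'⟩
  · obtain ⟨A, φ, hA, hφ, hsum⟩ := hSimple.1 h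
    exact ⟨φ, hφ, (hForm φ hφ).1 ⟨A, hA, hsum⟩⟩
  · obtain ⟨A, hA, hsum⟩ := (hForm φ hφ).2 h
    exact hSimple.2 ⟨A, φ, hA, hφ, hsum⟩
  · obtain ⟨A, φ, hA, hφ, hsum⟩ := hSimple.1 h
    refine ⟨φ, ⟨hφ, (hForm φ hφ).1 ⟨A, hA, hsum⟩⟩, fun φ' ⟨hφ', h'⟩ ↦ ?_⟩
    obtain ⟨A', hA', hsum'⟩ := (hForm φ' hφ').2 h'
    exact (hsum'.unique hn hD hA' hφ'.commutes hA hφ.commutes hsum).1
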